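/- Let $d\ge 1$ and let $\mathcal M_{\le 1}^{(2)}$ be the set of Borel measures on $\mathbb R^d\times\mathbb R^d$ of total mass at most $1$. For $\alpha\in\mathcal M_{\le1}^{(2)}$ let $\tilde\alpha$ be its orbit under the diagonal shifts, i.e. the set of the images of $\alpha$ under the maps $(u,v)\mapsto(u+x,v+x)$, $x\in\mathbb R^d$. Let $\tilde{\mathcal X}^{(2)}$ be the set of all empty, finite or countable collections (with repetitions allowed, i.e. multisets) $\xi=\{\tilde\alpha_i\}_{i\in I}$ of orbits of non-zero measures $\alpha_i\in\mathcal M_{\le1}^{(2)}$ with $\sum_{i\in I}\alpha_i(\mathbb R^d\times\mathbb R^d)\le 1$. For $k\ge2$ let $\mathcal F_{2k}$ be the space of continuous functions $f\colon(\mathbb R^d)^{2k}\to\mathbb R$ such that $f(x_1+x,\dots,x_{2k}+x)=f(x_1,\dots,x_{2k})$ for all $x,x_1,\dots,x_{2k}\in\mathbb R^d$ and $f(x_1,\dots,x_{2k})\to0$ as $\max_{i\ne j}|x_i-x_j|\to\infty$. For $f\in\mathcal F_{2k}$ the number $$\Lambda(f,\alpha)=\int f(u_1,v_1,\dots,u_k,v_k)\prod_{i=1}^k\alpha(\mathrm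 du_i,\mathrm dv_i)$$ depends only on $\tilde\alpha$. There is a sequence $(f_r)_{r\ge1}$ in the disjoint union $\bigcup_{k\ge2}\mathcal F_{2k}$ which is dense for the uniform metric, in the sense that for each $k\ge 2$ the terms that lie in $\mathcal F_{2k}$ are dense in $\mathcal F_{2k}$. Fix any such sequence and, for $\xi_1,\xi_2\in\tilde{\mathcal X}^{(2)}$, define $$\mathbf D_2(\xi_1,\xi_2)=\sum_{r\ge1}\frac1{2^r}\,\frac1{1+\|f_r\|_\infty}\,\Big|\sum_{\tilde\alpha\in\xi_1}\Lambda(f_r,\alpha)-\sum_{\tilde\alpha\in\xi_2}\Lambda(f_r,\alpha)\Big|,$$ where the sums over $\xi_1,\xi_2$ count repetitions. All these series converge absolutely, $\mathbf D_2$ is a metric on $\tilde{\mathcal X}^{(2)}$, and $(\tilde{\mathcal X}^{(2)},\mathbf D_2)$ is a compact metric space. Moreover, the set of the collections $\{\tilde\mu\}$ consisting of the single orbit of one probability measure $\mu$ on $\mathbb R^d\times\mathbb R^d$ is dense in $\tilde{\mathcal X}^{(2)}$. -/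

import Mathlib

open MeasureTheory Topology

namespace PairOrbits

noncomputable section

/-- The space `ℝ^d`. -/
abbrev E (d : ℕ) : Type := EuclideanSpace ℝ (Fin d)

/-- Sub-probability measures on `ℝ^d × ℝ^d`. -/
abbrev SubProb (d : ℕ) : Type := {α : Measure (E d × E d) // α Set.univ ≤ 1}

/-- The diagonal translation `(u, v) ↦ (u + x, v + x)`. -/
def shift {d : ℕ} (x : E d) (p : E d × E d) : E d × E d := (p.1 + x, p.2 + x)

lemma measurable_shift {d : ℕ} (x : E d) : Measurable (shift x) := by
  unfold shift
  fun_prop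

/-- Two sub-probability measures are equivalent when one is the image of the other under a
diagonal translation. -/
def subProbSetoid (d : ℕ) : Setoid (SubProb d) where
  r α β := ∃ x : E d, β.1 = α.1.map (shift x)
  iseqv := by
    refine ⟨fun α => ⟨0, ?_⟩, ?_, ?_⟩
    · have h : shift (0 : E d) = id := by
        funext p
        simp [shift]
      rw [h, Measure.map_id]
    · rintro α β ⟨x, hx⟩
      refine ⟨-x, ?_⟩
      rw [hx, Measure.map_map (measurable_shift _) (measurable_shift _)]
      have h : shift (-x) ∘ shift x = id := by
        funext p
        simp [shift]
      rw [h, Measure.map_id]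
    · rintro α β γ ⟨x, hx⟩ ⟨y, hy⟩
      refine ⟨x + y, ?_⟩
      rw [hy, hx, Measure.map_map (measurable_shift _) (measurable_shift _)]
      congr 1
      funext p
      simp [shift, add_assoc]

/-- The orbits of sub-probability measures under diagonal translations. -/
def Orbit (d : ℕ) : Type := Quotient (subProbSetoid d)

/-- The orbit of a sub-probability measure. -/
def orbitOf {d : ℕ} (α : SubProb d) : Orbit d := Quotient.mk (subProbSetoid d) α

/-- The total mass of an orbit. -/
def Orbit.mass {d : ℕ} (o : Orbit d) : ENNReal :=
  Quotient.lift (fun α : SubProb d => α.1 Set.univ)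
    (by
      rintro α β ⟨x, hx⟩
      rw [hx, Measure.map_apply (measurable_shift x) MeasurableSet.univ, Set.preimage_univ]) o

/-- Continuous real functions of `ℝ^d`-valued variables `(x_i)_{i ∈ ι}`, invariant under
translating all the variables by the same vector, and tending to `0` as
`max_{i ≠ j} |x_i - x_j| → ∞`. -/
structure InvC0 (d : ℕ) (ι : Type) where
  toFun : (ι → E d) → ℝ
  continuous' : Continuous toFun
  invariant' : ∀ (a : E d) (x : ι → E d), toFun (fun i => x i + a) = toFun x
  vanishing' : ∀ ε : ℝ, 0 < ε → ∃ R : ℝ, ∀ x : ι → E d,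
    (∃ i j, i ≠ j ∧ R < dist (x i) (x j)) → |toFun x| < ε

/-- The uniform norm. -/
def InvC0.supNorm {d : ℕ} {ι : Type} (f : InvC0 d ι) : ℝ := ⨆ x : ι → E d, |f.toFun x|

/-- The test functions of `2k` variables; the variables `u_1, …, u_k` carry the labels `Sum.inl i`
and the variables `v_1, …, v_k` carry the labels `Sum.inr i`. -/
abbrev TestFn (d k : ℕ) : Type := InvC0 d (Fin k ⊕ Fin k)

/-- The variables `(u_1, …, u_k, v_1, …, v_k)` of the `k` points `(u_i, v_i)`. -/
def coords {d k : ℕ} (p : Fin k → E d × E d) : Fin k ⊕ Fin k → E d :=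
  Sum.elim (fun i => (p i).1) (fun i => (p i).2)

/-- `Λ(f, α) = ∫ f(u_1, v_1, …, u_k, v_k) ∏ α(du_i, dv_i)`. -/
def Lam {d k : ℕ} (f : TestFn d k) (α : SubProb d) : ℝ :=
  ∫ p : Fin k → E d × E d, f.toFun (coords p) ∂(Measure.pi fun _ => α.1)

lemma isFiniteMeasure_subProb {d : ℕ} (α : SubProb d) : IsFiniteMeasure α.1 :=
  ⟨lt_of_le_of_lt α.2 ENNReal.one_lt_top⟩

/-- `Λ(f, α)` depends only on the orbit of `α`. -/
lemma Lam_eq_of_equiv {d k : ℕ} (f : TestFn d k) (α β : SubProb d)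
    (h : (subProbSetoid d).r α β) : Lam f α = Lam f β := by
  obtain ⟨x, hx⟩ := h
  have := isFiniteMeasure_subProb α
  have : IsFiniteMeasure (α.1.map (shift x)) := hx ▸ isFiniteMeasure_subProb β
  have hpi : (Measure.pi fun _ : Fin k => β.1) =
      (Measure.pi fun _ : Fin k => α.1).map (fun p i => shift x (p i)) := by
    rw [hx]
    exact (Measure.pi_map_pi (μ := fun _ : Fin k => α.1) (f := fun _ => shift x)
      (fun _ => (measurable_shift x).aemeasurable)).symm
  have hv : Continuous (coords : (Fin k → E d × E d) → _) := by
    refine continuous_pi ?_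
    rintro (i | i)
    · exact (continuous_apply i).fst
    · exact (continuous_apply i).snd
  unfold Lam
  rw [hpi, integral_map]
  · refine integral_congr_ae (Filter.Eventually.of_forall fun p => ?_)
    have hs : coords (fun i => shift x (p i)) = fun i => coords p i + x := by
      funext i
      rcases i with i | i <;> rfl
    change f.toFun (coords p) = f.toFun (coords fun i => shift x (p i))
    rw [hs, f.invariant' x]
  · exact (measurable_pi_lambda _ fun i =>
      (measurable_shift x).comp (measurable_pi_apply i)).aemeasurable
  · exact (f.continuous'.comp hv).aestronglyMeasurable

/-- `Λ(f, ·)` as a function of the orbit. -/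
def Orbit.Lam {d k : ℕ} (f : TestFn d k) (o : Orbit d) : ℝ :=
  Quotient.lift (fun α : SubProb d => PairOrbits.Lam f α)
    (fun α β h => Lam_eq_of_equiv f α β h) o

/-- The collections (multisets) `ξ = {α̃_i}_{i ∈ I}` of orbits of total mass at most `1`.
A collection is given by the number of times that each orbit occurs in it. The orbit of the
zero measure does not count as a member. All other orbits have positive mass, so the bound on
the total mass makes the collection countable and the multiplicities finite. -/
structure Collection (d : ℕ) where
  mult : Orbit d → ℕ
  mult_of_mass_eq_zero : ∀ o, o.mass = 0 → mult o = 0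
  mass_le_one : ∑' o, (mult o : ENNReal) * o.mass ≤ 1

/-- The summands of `∑_{α̃ ∈ ξ} Λ(f, α)`, grouped by orbits. -/
def Collection.term {d k : ℕ} (ξ : Collection d) (f : TestFn d k) (o : Orbit d) : ℝ :=
  (ξ.mult o : ℝ) * o.Lam f

/-- `∑_{α̃ ∈ ξ} Λ(f, α)`, with multiplicities. -/
def Collection.sumLam {d k : ℕ} (ξ : Collection d) (f : TestFn d k) : ℝ :=
  ∑' o, ξ.term f o

/-- The collections made of a single orbit, of a probability measure, occurring once. -/
def probOrbits (d : ℕ) : Set (Collection d) :=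
  {ξ | ∃ α : SubProb d, α.1 Set.univ = 1 ∧
    ξ.mult (orbitOf α) = 1 ∧ ∀ o, o ≠ orbitOf α → ξ.mult o = 0}

/-- The union over `k ≥ 2` of the spaces of test functions of `2k` variables. -/
abbrev AllTestFn (d : ℕ) : Type := Σ k : {k : ℕ // 2 ≤ k}, TestFn d k

/-- The sequence `f` is dense, for the uniform metric, among the test functions of `2k` variables,
for each `k ≥ 2`. -/
def IsDenseSequence {d : ℕ} (f : ℕ → AllTestFn d) : Prop :=
  ∀ (k : {k : ℕ // 2 ≤ k}) (g : TestFn d k) (ε : ℝ), 0 < ε →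
    ∃ (r : ℕ) (h : TestFn d k), f r = ⟨k, h⟩ ∧ ∀ x, |h.toFun x - g.toFun x| ≤ ε

/-- The summands of `D_2`; the sequence `f` is indexed from `0`, hence the exponent `r + 1`. -/
def D2term {d : ℕ} (f : ℕ → AllTestFn d) (ξ η : Collection d) (r : ℕ) : ℝ :=
  1 / 2 ^ (r + 1) * (1 / (1 + (f r).2.supNorm)) * |ξ.sumLam (f r).2 - η.sumLam (f r).2|

/-- The distance `D_2` defined by the sequence `f` of test functions. -/
def D2 {d : ℕ} (f : ℕ → AllTestFn d) (ξ η : Collection d) : ℝ :=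
  ∑' r, D2term f ξ η r

end

end PairOrbits

/-!
The proof treats the three assertions separately: the functionals separate the collections, every
collection is a limit of single orbits, and every sequence of single orbits has a cluster point.
All of them rest on the bound `|Λ(f, α)| ≤ ‖f‖ α(ℝ^d × ℝ^d)`. It makes the series for the distance
converge, and it reduces statements on the dense sequence to statements on all test functions of at
least two pairs of variables: if all the functionals converge, then so do the distances
(`tendsto_D2_zero`), and if a distance is `0`, then all the functionals agree
(`sumLam_eq_of_D2_eq_zero`).

*Separation* (`Collection.ext_of_sumLam`). Each collection has a Palm measure: choose a point
`(u, v)` according to the members of the collection, and look at its member from `u`. A view of a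
member is encoded as a point of the Hilbert cube, by the integrals of countably many functions that
determine finite measures (`exists_determining`). With a suitable positive weight, the moments of
the Palm measure are functionals of the collection (`Lam_palmFn`), so that the Palm measure is
determined by them (`measure_cube_ext`). Views of different orbits are different, and the part of
the Palm measure carried by the views of one orbit is the multiplicity of the orbit times a
positive number.

*Density* (`Collection.exists_prob_tendsto`). The members are placed side by side at distances
tending to infinity, and the missing mass is put on a pair of points that move apart. Test functions
vanish on tuples of points far from each other, so dominated convergence leaves only the tuples
inside one member.

*Compactness* (`tendsto_Lam_profileCollection`, `compactSpace_D2`). By density, only sequences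
`μ n` of single measures matter. Fix a nonprincipal ultrafilter. For each sequence of centers, the
measures `μ n` seen from these centers have a vague limit along the ultrafilter; centers at bounded
distance give the same limit up to translation. The limits attached to the classes of centers are
the members of the limiting collection. Different classes drift apart, so that the total mass is at
most `1` (`tsum_mass_profile_le`). After removing finitely many large profiles from `μ n`, no ball
of a fixed radius keeps much mass, since the centers of such balls would define another large
profile (`eventually_remainder_le`). A test function of at least two pairs of variables, which
vanishes unless all its variables are close together, does not see such a remainder.
-/

namespace PairOrbits

noncomputable section


/-! ### Bounds for the functionals `Λ` -/

instance instIsFiniteMeasureSubProb {d : ℕ} (α : SubProb d) : IsFiniteMeasure α.1 :=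
  isFiniteMeasure_subProb α

lemma InvC0.bddAbove {d : ℕ} {ι : Type} [Finite ι] [Nonempty ι] (f : InvC0 d ι) :
    BddAbove (Set.range fun x : ι → E d => |f.toFun x|) := by
  classical
  have := Fintype.ofFinite ι
  obtain ⟨R, hR⟩ := f.vanishing' 1 one_pos
  let i₀ : ι := Classical.arbitrary ι
  have hK : IsCompact (Set.univ.pi fun _ : ι => Metric.closedBall (0 : E d) (max R 0)) :=
    isCompact_univ_pi fun _ => isCompact_closedBall _ _
  obtain ⟨C, hC⟩ := hK.exists_bound_of_continuousOn f.continuous'.continuousOn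
  refine ⟨max C 1, ?_⟩
  rintro _ ⟨x, rfl⟩
  by_cases hx : ∃ i j, i ≠ j ∧ R < dist (x i) (x j)
  · exact (hR x hx).le.trans (le_max_right _ _)
  · push Not at hx
    have h := hC (fun i => x i + -x i₀) (fun i _ => by
      change x i + -x i₀ ∈ _
      rw [mem_closedBall_zero_iff, ← sub_eq_add_neg, ← dist_eq_norm]
      by_cases hi : i = i₀
      · rw [hi, dist_self]; exact le_max_right _ _
      · exact (hx i i₀ hi).trans (le_max_left _ _))
    rw [f.invariant', Real.norm_eq_abs] at h
    exact h.trans (le_max_left _ _)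

lemma InvC0.abs_le_supNorm {d : ℕ} {ι : Type} [Finite ι] [Nonempty ι] (f : InvC0 d ι)
    (x : ι → E d) : |f.toFun x| ≤ f.supNorm :=
  le_ciSup f.bddAbove x

lemma InvC0.supNorm_nonneg {d : ℕ} {ι : Type} (f : InvC0 d ι) : 0 ≤ f.supNorm :=
  Real.iSup_nonneg fun _ => abs_nonneg _

lemma continuous_coords {d k : ℕ} : Continuous (coords : (Fin k → E d × E d) → _) := by
  refine continuous_pi ?_
  rintro (i | i)
  · exact (continuous_apply i).fst
  · exact (continuous_apply i).snd

lemma continuous_shift {d : ℕ} (x : E d) : Continuous (shift x) := by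
  unfold shift
  fun_prop

lemma integrable_testFn {d k : ℕ} (hk : 1 ≤ k) (f : TestFn d k)
    (μ : Measure (Fin k → E d × E d)) [IsFiniteMeasure μ] :
    Integrable (fun p => f.toFun (coords p)) μ := by
  have : Nonempty (Fin k) := ⟨⟨0, hk⟩⟩
  refine Integrable.of_bound (f.continuous'.comp continuous_coords).aestronglyMeasurable
    f.supNorm (Filter.Eventually.of_forall fun p => ?_)
  exact f.abs_le_supNorm _

/-- The total mass as a real number. -/
def Orbit.realMass {d : ℕ} (o : Orbit d) : ℝ := o.mass.toReal

lemma mass_orbitOf {d : ℕ} (α : SubProb d) : (orbitOf α).mass = α.1 Set.univ := rfl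

lemma Lam_orbitOf {d k : ℕ} (f : TestFn d k) (α : SubProb d) : (orbitOf α).Lam f = Lam f α := rfl

lemma realMass_orbitOf {d : ℕ} (α : SubProb d) : (orbitOf α).realMass = α.1.real Set.univ := rfl

lemma Orbit.exists_rep {d : ℕ} (o : Orbit d) : ∃ α : SubProb d, orbitOf α = o :=
  Quotient.exists_rep o

lemma Orbit.mass_le_one {d : ℕ} (o : Orbit d) : o.mass ≤ 1 := by
  obtain ⟨α, rfl⟩ := o.exists_rep
  exact α.2

lemma SubProb.real_univ_le_one {d : ℕ} (α : SubProb d) : α.1.real Set.univ ≤ 1 := by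
  have := ENNReal.toReal_mono ENNReal.one_ne_top α.2
  simpa [Measure.real] using this

lemma pi_real_univ_le {d k : ℕ} (hk : 1 ≤ k) (α : SubProb d) :
    (Measure.pi fun _ : Fin k => α.1).real Set.univ ≤ α.1.real Set.univ := by
  rw [Measure.real, Measure.pi_univ, ENNReal.toReal_prod]
  simp only [Finset.prod_const, Finset.card_univ, Fintype.card_fin]
  exact pow_le_of_le_one ENNReal.toReal_nonneg α.real_univ_le_one (by omega)

/-- Since `α(ℝ^d × ℝ^d) ≤ 1`, the mass of the product measure is at most that of `α`; the bound by
the mass to the power one is what can be summed over a collection. -/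
lemma abs_Lam_sub_le {d k : ℕ} (hk : 1 ≤ k) (f g : TestFn d k) {δ : ℝ} (hδ : 0 ≤ δ)
    (h : ∀ x, |f.toFun x - g.toFun x| ≤ δ) (α : SubProb d) :
    |Lam f α - Lam g α| ≤ δ * α.1.real Set.univ := by
  unfold Lam
  rw [← integral_sub (integrable_testFn hk f _) (integrable_testFn hk g _)]
  rw [← Real.norm_eq_abs]
  refine (norm_integral_le_of_norm_le_const (C := δ)
    (Filter.Eventually.of_forall fun p => h (coords p))).trans ?_
  exact mul_le_mul_of_nonneg_left (pi_real_univ_le hk α) hδ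

lemma abs_Lam_le {d k : ℕ} (hk : 1 ≤ k) (f : TestFn d k) (α : SubProb d) :
    |Lam f α| ≤ f.supNorm * α.1.real Set.univ := by
  have : Nonempty (Fin k) := ⟨⟨0, hk⟩⟩
  unfold Lam
  rw [← Real.norm_eq_abs]
  refine (norm_integral_le_of_norm_le_const (C := f.supNorm)
    (Filter.Eventually.of_forall fun p => f.abs_le_supNorm (coords p))).trans ?_
  exact mul_le_mul_of_nonneg_left (pi_real_univ_le hk α) f.supNorm_nonneg

lemma Orbit.abs_Lam_sub_le {d k : ℕ} (hk : 1 ≤ k) (f g : TestFn d k) {δ : ℝ} (hδ : 0 ≤ δ)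
    (h : ∀ x, |f.toFun x - g.toFun x| ≤ δ) (o : Orbit d) :
    |o.Lam f - o.Lam g| ≤ δ * o.realMass := by
  obtain ⟨α, rfl⟩ := o.exists_rep
  exact PairOrbits.abs_Lam_sub_le hk f g hδ h α

lemma Orbit.abs_Lam_le {d k : ℕ} (hk : 1 ≤ k) (f : TestFn d k) (o : Orbit d) :
    |o.Lam f| ≤ f.supNorm * o.realMass := by
  obtain ⟨α, rfl⟩ := o.exists_rep
  exact PairOrbits.abs_Lam_le hk f α

lemma Collection.summable_realMass {d : ℕ} (ξ : Collection d) :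
    Summable (fun o => (ξ.mult o : ℝ) * o.realMass) ∧
      ∑' o, (ξ.mult o : ℝ) * o.realMass ≤ 1 := by
  have hne : ∑' o, (ξ.mult o : ENNReal) * o.mass ≠ ⊤ :=
    ne_top_of_le_ne_top ENNReal.one_ne_top ξ.mass_le_one
  have heq : (fun o : Orbit d => (ξ.mult o : ℝ) * o.realMass) =
      fun o => ((ξ.mult o : ENNReal) * o.mass).toReal := by
    funext o
    simp [Orbit.realMass]
  rw [heq]
  refine ⟨ENNReal.summable_toReal hne, ?_⟩
  rw [← ENNReal.tsum_toReal_eq fun o => ENNReal.ne_top_of_tsum_ne_top hne o]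
  exact ENNReal.toReal_le_of_le_ofReal zero_le_one (by simpa using ξ.mass_le_one)

lemma Collection.summable_term {d k : ℕ} (hk : 1 ≤ k) (ξ : Collection d) (f : TestFn d k) :
    Summable (ξ.term f) := by
  refine Summable.of_norm_bounded (ξ.summable_realMass.1.mul_left f.supNorm) fun o => ?_
  rw [Collection.term, Real.norm_eq_abs, abs_mul, Nat.abs_cast]
  have := mul_le_mul_of_nonneg_left (o.abs_Lam_le hk f) (Nat.cast_nonneg (α := ℝ) (ξ.mult o))
  linarith

lemma Collection.abs_sumLam_sub_le {d k : ℕ} (hk : 1 ≤ k) (f g : TestFn d k) {δ : ℝ}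
    (hδ : 0 ≤ δ) (h : ∀ x, |f.toFun x - g.toFun x| ≤ δ) (ξ : Collection d) :
    |ξ.sumLam f - ξ.sumLam g| ≤ δ := by
  unfold Collection.sumLam
  rw [← (ξ.summable_term hk f).tsum_sub (ξ.summable_term hk g)]
  have hs := ξ.summable_realMass.1.mul_left δ
  rw [← Real.norm_eq_abs]
  refine (tsum_of_norm_bounded hs.hasSum fun o => ?_).trans ?_
  · rw [Collection.term, Collection.term, ← mul_sub, Real.norm_eq_abs, abs_mul, Nat.abs_cast]
    have := mul_le_mul_of_nonneg_left (o.abs_Lam_sub_le hk f g hδ h)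
      (Nat.cast_nonneg (α := ℝ) (ξ.mult o))
    linarith
  · rw [tsum_mul_left]
    exact mul_le_of_le_one_right hδ ξ.summable_realMass.2

lemma Collection.abs_sumLam_le {d k : ℕ} (hk : 1 ≤ k) (f : TestFn d k) (ξ : Collection d) :
    |ξ.sumLam f| ≤ f.supNorm := by
  have hs := ξ.summable_realMass.1.mul_left f.supNorm
  rw [← Real.norm_eq_abs]
  refine (tsum_of_norm_bounded hs.hasSum fun o => ?_).trans ?_
  · rw [Collection.term, Real.norm_eq_abs, abs_mul, Nat.abs_cast]
    have := mul_le_mul_of_nonneg_left (o.abs_Lam_le hk f) (Nat.cast_nonneg (α := ℝ) (ξ.mult o))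
    linarith
  · rw [tsum_mul_left]
    exact mul_le_of_le_one_right f.supNorm_nonneg ξ.summable_realMass.2

/-! ### Collections given by indexed families -/

lemma tsum_eq_tsum_fiber {I O : Type} (o : I → O) (F : I → ENNReal) :
    ∑' i, F i = ∑' x, ∑' i : {i // o i = x}, F i := by
  rw [← (Equiv.sigmaFiberEquiv o).tsum_eq F, ENNReal.tsum_sigma']
  rfl

lemma finite_fiber {d : ℕ} {I : Type} (o : I → Orbit d) (h : ∑' i, (o i).mass ≤ 1)
    {x : Orbit d} (hx : x.mass ≠ 0) : Finite {i // o i = x} := by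
  by_contra hinf
  rw [not_finite_iff_infinite] at hinf
  have h1 : ∑' i : {i // o i = x}, (o i).mass = ⊤ := by
    have : (fun i : {i // o i = x} => (o i).mass) = fun _ => x.mass := by
      funext i
      rw [i.2]
    rw [this]
    exact ENNReal.tsum_const_eq_top_of_ne_zero hx
  have h2 : ∑' i : {i // o i = x}, (o i).mass ≤ 1 :=
    (ENNReal.tsum_comp_le_tsum_of_injective Subtype.val_injective _).trans h
  rw [h1] at h2
  exact absurd h2 (by simp)

open Classical in
/-- The multiplicity function of a family of orbits; the members of mass zero are discarded. -/
def familyMult {d : ℕ} {I : Type} (o : I → Orbit d) (x : Orbit d) : ℕ :=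
  if x.mass = 0 then 0 else Nat.card {i // o i = x}

lemma familyMult_mul_mass {d : ℕ} {I : Type} (o : I → Orbit d) (h : ∑' i, (o i).mass ≤ 1)
    (x : Orbit d) : (familyMult o x : ENNReal) * x.mass = ∑' i : {i // o i = x}, (o i).mass := by
  have hc : (fun i : {i // o i = x} => (o i).mass) = fun _ => x.mass := by
    funext i
    rw [i.2]
  rw [hc]
  by_cases hx : x.mass = 0
  · simp [hx]
  · have := finite_fiber o h hx
    have := Fintype.ofFinite {i // o i = x}
    rw [familyMult, if_neg hx, tsum_fintype, Finset.sum_const, nsmul_eq_mul,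
      Nat.card_eq_fintype_card, Finset.card_univ]

/-- The collection formed by a family of orbits, each taken as often as it is listed. -/
def ofFamily {d : ℕ} {I : Type} (o : I → Orbit d) (h : ∑' i, (o i).mass ≤ 1) : Collection d where
  mult := familyMult o
  mult_of_mass_eq_zero x hx := if_pos hx
  mass_le_one := by
    simp_rw [familyMult_mul_mass o h, ← tsum_eq_tsum_fiber o fun i => (o i).mass]
    exact h

lemma Orbit.Lam_eq_zero {d k : ℕ} (hk : 1 ≤ k) (f : TestFn d k) {o : Orbit d} (h : o.mass = 0) :
    o.Lam f = 0 := by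
  have := o.abs_Lam_le hk f
  rw [Orbit.realMass, h, ENNReal.toReal_zero, mul_zero] at this
  exact abs_nonpos_iff.1 this

lemma summable_realMass {d : ℕ} {I : Type} (o : I → Orbit d) (h : ∑' i, (o i).mass ≤ 1) :
    Summable fun i => (o i).realMass :=
  ENNReal.summable_toReal (ne_top_of_le_ne_top ENNReal.one_ne_top h)

lemma summable_Lam {d k : ℕ} (hk : 1 ≤ k) {I : Type} (o : I → Orbit d)
    (h : ∑' i, (o i).mass ≤ 1) (f : TestFn d k) : Summable fun i => (o i).Lam f :=
  Summable.of_norm_bounded ((summable_realMass o h).mul_left f.supNorm)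
    fun i => (o i).abs_Lam_le hk f

lemma sumLam_ofFamily {d k : ℕ} (hk : 1 ≤ k) {I : Type} (o : I → Orbit d)
    (h : ∑' i, (o i).mass ≤ 1) (f : TestFn d k) :
    (ofFamily o h).sumLam f = ∑' i, (o i).Lam f := by
  rw [← ((summable_Lam hk o h f).hasSum.tsum_fiberwise o).tsum_eq]
  refine tsum_congr fun x => ?_
  change (familyMult o x : ℝ) * x.Lam f = ∑' i : {i // o i = x}, (o i).Lam f
  have hc : (fun i : {i // o i = x} => (o i).Lam f) = fun _ => x.Lam f := by
    funext i
    rw [i.2]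
  rw [hc]
  by_cases hx : x.mass = 0
  · simp [Orbit.Lam_eq_zero hk f hx]
  · have := finite_fiber o h hx
    have := Fintype.ofFinite {i // o i = x}
    rw [familyMult, if_neg hx, tsum_fintype, Finset.sum_const, nsmul_eq_mul,
      Nat.card_eq_fintype_card, Finset.card_univ]

/-- The members of a collection can be listed as a sequence, padded with zero measures. -/
lemma Collection.exists_sequence {d : ℕ} (ξ : Collection d) :
    ∃ α : ℕ → SubProb d, ∑' j, (α j).1 Set.univ ≤ 1 ∧
      ∀ (k : ℕ) (_ : 1 ≤ k) (f : TestFn d k), ξ.sumLam f = ∑' j, Lam f (α j) := by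
  classical
  let I : Type := Σ o : Orbit d, Fin (ξ.mult o)
  have hmass : ∑' i : I, i.1.mass = ∑' o, (ξ.mult o : ENNReal) * o.mass := by
    rw [ENNReal.tsum_sigma']
    refine tsum_congr fun o => ?_
    simp
  have hI : ∑' i : I, i.1.mass ≤ 1 := hmass.trans_le ξ.mass_le_one
  have hcount : Countable I := by
    have hs := Summable.countable_support_ennreal (ne_top_of_le_ne_top ENNReal.one_ne_top hI)
    have : (Function.support fun i : I => i.1.mass) = Set.univ := by
      refine Set.eq_univ_of_forall fun i => ?_
      rw [Function.mem_support]
      intro h0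
      have := ξ.mult_of_mass_eq_zero _ h0
      exact absurd i.2.2 (by omega)
    rw [this] at hs
    exact Set.countable_univ_iff.1 hs
  obtain ⟨e, he⟩ := exists_injective_nat I
  let zero : SubProb d := ⟨0, by simp⟩
  let rep : I → SubProb d := fun i => Quotient.out i.1
  have hrep : ∀ i, orbitOf (rep i) = i.1 := fun i => Quotient.out_eq _
  let α : ℕ → SubProb d := Function.extend e rep fun _ => zero
  have hα : ∀ i, α (e i) = rep i := fun i => he.extend_apply _ _ _
  have hα0 : ∀ j, j ∉ Set.range e → α j = zero := fun j hj =>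
    Function.extend_apply' _ _ _ (by simpa using hj)
  refine ⟨α, ?_, fun k hk f => ?_⟩
  · rw [← he.tsum_eq]
    · calc ∑' i, (α (e i)).1 Set.univ = ∑' i : I, i.1.mass := by
            refine tsum_congr fun i => ?_
            rw [hα, ← mass_orbitOf, hrep]
        _ ≤ 1 := hI
    · intro j hj
      by_contra hn
      exact hj (by simp [hα0 j hn, zero])
  · have hsupp : Function.support (fun j => Lam f (α j)) ⊆ Set.range e := by
      intro j hj
      by_contra hn
      refine hj ?_
      change Lam f (α j) = 0
      rw [hα0 j hn, ← Lam_orbitOf]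
      exact Orbit.Lam_eq_zero hk f (by simp [mass_orbitOf, zero])
    rw [← he.tsum_eq hsupp]
    have hc : (fun i => Lam f (α (e i))) = fun i : I => i.1.Lam f := by
      funext i
      rw [hα, ← Lam_orbitOf, hrep]
    rw [hc, (summable_Lam hk (fun i : I => i.1) hI f).tsum_sigma]
    refine tsum_congr fun o => ?_
    simp [Collection.term]


/-! ### Uniform separability of the test functions -/

/-- The truncation of a real number to the interval `[0, 1]`. -/
def clamp01 (t : ℝ) : ℝ := max 0 (min 1 t)

lemma continuous_clamp01 : Continuous clamp01 := by
  unfold clamp01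
  fun_prop

lemma clamp01_nonneg (t : ℝ) : 0 ≤ clamp01 t := le_max_left _ _

lemma clamp01_le_one (t : ℝ) : clamp01 t ≤ 1 := max_le zero_le_one (min_le_left _ _)

lemma clamp01_of_nonpos {t : ℝ} (h : t ≤ 0) : clamp01 t = 0 :=
  max_eq_left ((min_le_right _ _).trans h)

lemma clamp01_of_one_le {t : ℝ} (h : 1 ≤ t) : clamp01 t = 1 := by
  rw [clamp01, min_eq_left h, max_eq_right zero_le_one]

lemma clamp01_of_mem {t : ℝ} (h0 : 0 ≤ t) (h1 : t ≤ 1) : clamp01 t = t := by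
  rw [clamp01, min_eq_right h1, max_eq_right h0]

section Recenter

variable {d : ℕ} {ι : Type}

/-- The configuration `x` seen from its point number `i₀`. -/
def recenter (i₀ : ι) (x : ι → E d) : ι → E d := fun i => x i - x i₀

lemma continuous_recenter (i₀ : ι) : Continuous (recenter (d := d) i₀) := by
  unfold recenter
  fun_prop

lemma recenter_add (i₀ : ι) (a : E d) (x : ι → E d) :
    recenter i₀ (fun i => x i + a) = recenter i₀ x := by
  funext i
  simp [recenter]

lemma InvC0.recenter_eq (f : InvC0 d ι) (i₀ : ι) (x : ι → E d) :
    f.toFun (recenter i₀ x) = f.toFun x := by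
  rw [← f.invariant' (-x i₀) x]
  congr 1

lemma dist_le_norm_recenter [Fintype ι] (i₀ : ι) (x : ι → E d) (i j : ι) :
    dist (x i) (x j) ≤ 2 * ‖recenter i₀ x‖ := by
  have h1 := norm_le_pi_norm (recenter i₀ x) i
  have h2 := norm_le_pi_norm (recenter i₀ x) j
  have h3 : x i - x j = recenter i₀ x i - recenter i₀ x j := by simp [recenter]
  rw [dist_eq_norm, h3]
  exact (norm_sub_le _ _).trans (by linarith)

/-- The function `c` restricted to configurations with one point at the origin, cut off at
distance `R`, and extended by translation. -/
def cutoffFn [Fintype ι] (i₀ : ι) (c : C(ι → E d, ℝ)) (R : ℝ) : InvC0 d ι where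
  toFun x := clamp01 (R + 1 - ‖recenter i₀ x‖) * c (recenter i₀ x)
  continuous' := by
    have h := continuous_recenter (d := d) i₀
    exact (continuous_clamp01.comp (continuous_const.sub h.norm)).mul (c.continuous.comp h)
  invariant' a x := by rw [recenter_add]
  vanishing' ε hε := by
    refine ⟨2 * (R + 1), fun x ⟨i, j, _, hx⟩ => ?_⟩
    have := dist_le_norm_recenter i₀ x i j
    rw [clamp01_of_nonpos (by linarith), zero_mul, abs_zero]
    exact hε

lemma exists_dense_invC0 [Fintype ι] [Nonempty ι] : ∃ h : ℕ × ℕ → InvC0 d ι,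
    ∀ (g : InvC0 d ι) (ε : ℝ), 0 < ε → ∃ n, ∀ x, |(h n).toFun x - g.toFun x| ≤ ε := by
  let i₀ : ι := Classical.arbitrary ι
  let c : ℕ → C(ι → E d, ℝ) := TopologicalSpace.denseSeq _
  refine ⟨fun n => cutoffFn i₀ (c n.1) n.2, fun g ε hε => ?_⟩
  obtain ⟨R₀, hR₀⟩ := g.vanishing' ε hε
  obtain ⟨R, hR⟩ := exists_nat_ge R₀
  have hK : IsCompact (Metric.closedBall (0 : ι → E d) (R + 1)) := isCompact_closedBall _ _
  obtain ⟨n, hn⟩ : ∃ n, ∀ y ∈ Metric.closedBall (0 : ι → E d) (R + 1),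
      |c n y - g.toFun y| < ε := by
    have h1 : (⟨g.toFun, g.continuous'⟩ : C(ι → E d, ℝ)) ∈ closure (Set.range c) :=
      TopologicalSpace.denseRange_denseSeq _ _
    obtain ⟨u, hu, hlim⟩ := mem_closure_iff_seq_limit.1 h1
    rw [ContinuousMap.tendsto_iff_forall_isCompact_tendstoUniformlyOn] at hlim
    have h2 := Metric.tendstoUniformlyOn_iff.1 (hlim _ hK) ε hε
    obtain ⟨m, hm⟩ := h2.exists
    obtain ⟨n, hn⟩ := hu m
    refine ⟨n, fun y hy => ?_⟩
    have h3 := hm y hy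
    rw [← hn, dist_comm, Real.dist_eq] at h3
    exact h3
  refine ⟨(n, R), fun x => ?_⟩
  rw [← g.recenter_eq i₀]
  change |clamp01 (R + 1 - ‖recenter i₀ x‖) * c n (recenter i₀ x) - _| ≤ ε
  set y := recenter i₀ x with hy
  set t := clamp01 (R + 1 - ‖y‖) with ht
  have ht0 : 0 ≤ t := clamp01_nonneg _
  have ht1 : t ≤ 1 := clamp01_le_one _
  have hfar : (R : ℝ) < ‖y‖ → |g.toFun y| < ε := fun hlt => by
    have h1 : ∃ i, (R : ℝ) < ‖y i‖ := by
      by_contra hcon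
      push Not at hcon
      exact absurd ((pi_norm_le_iff_of_nonneg (Nat.cast_nonneg R)).2 hcon) (not_le.2 hlt)
    obtain ⟨i, hi⟩ := h1
    have hy0 : y i₀ = 0 := by simp [hy, recenter]
    refine hR₀ y ⟨i, i₀, ?_, ?_⟩
    · rintro rfl
      rw [hy0, norm_zero] at hi
      exact absurd hi (not_lt.2 (Nat.cast_nonneg R))
    · rw [hy0, dist_zero_right]
      exact hR.trans_lt hi
  have hsplit : t * c n y - g.toFun y = t * (c n y - g.toFun y) - (1 - t) * g.toFun y := by ring
  have h1 : |t * (c n y - g.toFun y)| ≤ t * ε := by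
    rw [abs_mul, abs_of_nonneg ht0]
    by_cases hin : ‖y‖ ≤ R + 1
    · exact mul_le_mul_of_nonneg_left (hn y (mem_closedBall_zero_iff.2 hin)).le ht0
    · have : t = 0 := clamp01_of_nonpos (by linarith)
      simp [this]
  have h2 : |(1 - t) * g.toFun y| ≤ (1 - t) * ε := by
    rw [abs_mul, abs_of_nonneg (by linarith)]
    by_cases hin : ‖y‖ ≤ R
    · have : t = 1 := clamp01_of_one_le (by linarith)
      simp [this]
    · exact mul_le_mul_of_nonneg_left (hfar (not_le.1 hin)).le (by linarith)
  rw [hsplit]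
  exact (abs_sub _ _).trans (by linarith)

end Recenter

lemma exists_isDenseSequence (d : ℕ) : ∃ f : ℕ → AllTestFn d, IsDenseSequence f := by
  have hne : ∀ k : {k : ℕ // 2 ≤ k}, Nonempty (Fin k.1 ⊕ Fin k.1) := fun k =>
    ⟨Sum.inl ⟨0, by have := k.2; omega⟩⟩
  have hex : ∀ k : {k : ℕ // 2 ≤ k}, ∃ h : ℕ × ℕ → TestFn d k,
      ∀ (g : TestFn d k) (ε : ℝ), 0 < ε → ∃ n, ∀ x, |(h n).toFun x - g.toFun x| ≤ ε := fun k => by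
    have := hne k
    exact exists_dense_invC0
  choose h hh using hex
  have : Nonempty {k : ℕ // 2 ≤ k} := ⟨⟨2, le_rfl⟩⟩
  obtain ⟨s, hs⟩ := exists_surjective_nat ({k : ℕ // 2 ≤ k} × ℕ × ℕ)
  refine ⟨fun r => ⟨(s r).1, h (s r).1 (s r).2⟩, fun k g ε hε => ?_⟩
  obtain ⟨n, hn⟩ := hh k g ε hε
  obtain ⟨r, hr⟩ := hs (k, n)
  refine ⟨r, h k n, ?_, hn⟩
  change (⟨(s r).1, h (s r).1 (s r).2⟩ : AllTestFn d) = ⟨k, h k n⟩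
  rw [hr]

/-! ### The series defining the distance -/

section Distance

variable {d : ℕ} (f : ℕ → AllTestFn d)

lemma one_le_index (r : ℕ) : 1 ≤ (f r).1.1 := one_le_two.trans (f r).1.2

lemma D2term_nonneg (ξ η : Collection d) (r : ℕ) : 0 ≤ D2term f ξ η r := by
  have := (f r).2.supNorm_nonneg
  unfold D2term
  positivity

lemma D2term_le (ξ η : Collection d) (r : ℕ) : D2term f ξ η r ≤ (1 / 2) ^ r := by
  have h0 := (f r).2.supNorm_nonneg
  have h1 := ξ.abs_sumLam_le (one_le_index f r) (f r).2
  have h2 := η.abs_sumLam_le (one_le_index f r) (f r).2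
  have h3 : |ξ.sumLam (f r).2 - η.sumLam (f r).2| ≤ 2 * (1 + (f r).2.supNorm) :=
    (abs_sub _ _).trans (by linarith)
  have hc : 0 ≤ 1 / 2 ^ (r + 1) * (1 / (1 + (f r).2.supNorm)) := by positivity
  refine (mul_le_mul_of_nonneg_left h3 hc).trans (le_of_eq ?_)
  have : 1 + (f r).2.supNorm ≠ 0 := by positivity
  field_simp
  rw [pow_succ, mul_right_comm, ← mul_pow]
  norm_num

lemma summable_D2term (ξ η : Collection d) : Summable (D2term f ξ η) :=
  Summable.of_nonneg_of_le (D2term_nonneg f ξ η) (D2term_le f ξ η) summable_geometric_two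

lemma D2_comm (ξ η : Collection d) : D2 f ξ η = D2 f η ξ := by
  refine tsum_congr fun r => ?_
  rw [D2term, D2term, abs_sub_comm]

lemma D2_self (ξ : Collection d) : D2 f ξ ξ = 0 := by
  simp [D2, D2term]

lemma D2_triangle (ξ η ζ : Collection d) : D2 f ξ ζ ≤ D2 f ξ η + D2 f η ζ := by
  unfold D2
  rw [← (summable_D2term f ξ η).tsum_add (summable_D2term f η ζ)]
  refine Summable.tsum_le_tsum (fun r => ?_) (summable_D2term f ξ ζ)
    ((summable_D2term f ξ η).add (summable_D2term f η ζ))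
  have h0 := (f r).2.supNorm_nonneg
  have hc : 0 ≤ 1 / 2 ^ (r + 1) * (1 / (1 + (f r).2.supNorm)) := by positivity
  rw [D2term, D2term, D2term, ← mul_add]
  exact mul_le_mul_of_nonneg_left (abs_sub_le _ _ _) hc

variable {f}

lemma sumLam_eq_of_D2_eq_zero (hf : IsDenseSequence f) {ξ η : Collection d} (h : D2 f ξ η = 0)
    {k : ℕ} (hk : 2 ≤ k) (g : TestFn d k) : ξ.sumLam g = η.sumLam g := by
  have hterm : ∀ r, ξ.sumLam (f r).2 = η.sumLam (f r).2 := fun r => by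
    have h1 : D2term f ξ η r = 0 := by
      refine le_antisymm ?_ (D2term_nonneg f ξ η r)
      rw [← h]
      exact (summable_D2term f ξ η).le_tsum r fun j _ => D2term_nonneg f ξ η j
    have h0 := (f r).2.supNorm_nonneg
    have hc : 1 / 2 ^ (r + 1) * (1 / (1 + (f r).2.supNorm)) ≠ 0 := by positivity
    exact sub_eq_zero.1 (abs_eq_zero.1 ((mul_eq_zero.1 h1).resolve_left hc))
  refine eq_of_abs_sub_le_all fun ε hε => ?_
  obtain ⟨r, q, hr, hq⟩ := hf ⟨k, hk⟩ g (ε / 2) (half_pos hε)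
  have hk1 : 1 ≤ k := one_le_two.trans hk
  have h1 := ξ.abs_sumLam_sub_le hk1 q g (half_pos hε).le hq
  have h2 := η.abs_sumLam_sub_le hk1 q g (half_pos hε).le hq
  have h3 : ξ.sumLam q = η.sumLam q := by
    have := hterm r
    rw [hr] at this
    exact this
  rw [h3] at h1
  rw [abs_sub_comm] at h1
  calc |ξ.sumLam g - η.sumLam g|
      ≤ |ξ.sumLam g - η.sumLam q| + |η.sumLam q - η.sumLam g| := abs_sub_le _ _ _
    _ ≤ ε := by linarith

/-- Convergence of all the functionals implies convergence for the distance. -/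
lemma tendsto_D2_zero {ι : Type} {l : Filter ι} {u : ι → Collection d} {ξ : Collection d}
    (h : ∀ (k : ℕ) (_ : 2 ≤ k) (g : TestFn d k),
      Filter.Tendsto (fun i => (u i).sumLam g) l (𝓝 (ξ.sumLam g))) :
    Filter.Tendsto (fun i => D2 f (u i) ξ) l (𝓝 0) := by
  have h0 : ∑' _ : ℕ, (0 : ℝ) = 0 := tsum_zero
  rw [← h0]
  refine tendsto_tsum_of_dominated_convergence summable_geometric_two (fun r => ?_)
    (Filter.Eventually.of_forall fun i r => ?_)
  · have h1 := ((h _ (f r).1.2 (f r).2).sub_const (ξ.sumLam (f r).2)).abs.const_mul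
      (1 / 2 ^ (r + 1) * (1 / (1 + (f r).2.supNorm)))
    simpa [D2term] using h1
  · rw [Real.norm_of_nonneg (D2term_nonneg _ _ _ _)]
    exact D2term_le _ _ _ _

end Distance


/-! ### Countable families of functions that determine finite measures -/

/-- A continuous function with values in `(0, 1]` that tends to `0` at infinity. -/
def decay {V : Type*} [Norm V] (z : V) : ℝ := (1 + ‖z‖)⁻¹

section Decay

variable {V : Type*} [NormedAddCommGroup V]

lemma decay_pos (z : V) : 0 < decay z := by
  unfold decay
  positivity

lemma decay_le_one (z : V) : decay z ≤ 1 :=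
  inv_le_one_of_one_le₀ (by linarith [norm_nonneg z])

lemma continuous_decay : Continuous (decay : V → ℝ) := by
  unfold decay
  refine (continuous_const.add continuous_norm).inv₀ fun z => ?_
  have := norm_nonneg z
  exact (by linarith : (0 : ℝ) < 1 + ‖z‖).ne'

lemma decay_lt {ε : ℝ} (hε : 0 < ε) {z : V} (h : 1 / ε < ‖z‖) : decay z < ε := by
  unfold decay
  rw [inv_lt_comm₀ (by positivity) hε]
  rw [one_div] at h
  linarith

end Decay

lemma integrable_of_mem_unit {X : Type*} [TopologicalSpace X] [MeasurableSpace X]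
    [OpensMeasurableSpace X] {μ : Measure X} [IsFiniteMeasure μ] {g : X → ℝ}
    (hg : Continuous g) (h0 : ∀ x, 0 ≤ g x) (h1 : ∀ x, g x ≤ 1) : Integrable g μ :=
  Integrable.of_bound hg.measurable.aestronglyMeasurable 1
    (Filter.Eventually.of_forall fun x => by
      rw [Real.norm_of_nonneg (h0 x)]
      exact h1 x)

lemma integral_withDensity_ofReal {X : Type*} [MeasurableSpace X] {μ : Measure X}
    {W : X → ℝ} (hW : Measurable W) (hW0 : ∀ x, 0 ≤ W x) (φ : X → ℝ) :
    ∫ x, φ x ∂(μ.withDensity fun x => ENNReal.ofReal (W x)) = ∫ x, W x * φ x ∂μ := by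
  rw [integral_withDensity_eq_integral_toReal_smul hW.ennreal_ofReal
    (Filter.Eventually.of_forall fun x => ENNReal.ofReal_lt_top)]
  refine integral_congr_ae (Filter.Eventually.of_forall fun x => ?_)
  simp [ENNReal.toReal_ofReal (hW0 x)]

lemma isFiniteMeasure_withDensity_unit {X : Type*} [MeasurableSpace X] {μ : Measure X}
    [IsFiniteMeasure μ] {W : X → ℝ} (hW1 : ∀ x, W x ≤ 1) :
    IsFiniteMeasure (μ.withDensity fun x => ENNReal.ofReal (W x)) := by
  refine isFiniteMeasure_withDensity (ne_of_lt ?_)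
  calc ∫⁻ x, ENNReal.ofReal (W x) ∂μ ≤ ∫⁻ _, 1 ∂μ :=
        lintegral_mono fun x => ENNReal.ofReal_le_one.2 (hW1 x)
    _ < ⊤ := by simp

/-- Countably many continuous functions with values in `[0, 1]`, multiplied by an arbitrary fixed
positive weight, determine all finite measures. -/
lemma exists_determining (X : Type*) [MetricSpace X] [ProperSpace X] [MeasurableSpace X]
    [BorelSpace X] (w : X → ℝ) (hw : Continuous w) (hw0 : ∀ x, 0 < w x) (hw1 : ∀ x, w x ≤ 1) :
    ∃ c : ℕ → X → ℝ, (∀ n, Continuous (c n)) ∧ (∀ n x, 0 ≤ c n x) ∧ (∀ n x, c n x ≤ 1) ∧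
      ∀ (μ ν : Measure X) [IsFiniteMeasure μ] [IsFiniteMeasure ν],
        (∀ n, ∫ x, c n x * w x ∂μ = ∫ x, c n x * w x ∂ν) → μ = ν := by
  let s : ℕ → C(X, ℝ) := TopologicalSpace.denseSeq _
  refine ⟨fun n x => clamp01 (s n x), fun n => continuous_clamp01.comp (s n).continuous,
    fun n x => clamp01_nonneg _, fun n x => clamp01_le_one _, fun μ ν _ _ h => ?_⟩
  have key : ∀ ψ : X → ℝ, Continuous ψ → (∀ x, 0 ≤ ψ x) → (∀ x, ψ x ≤ 1) →
      ∫ x, ψ x * w x ∂μ = ∫ x, ψ x * w x ∂ν := by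
    intro ψ hψ h0 h1
    have hcl : (⟨ψ, hψ⟩ : C(X, ℝ)) ∈ closure (Set.range s) :=
      TopologicalSpace.denseRange_denseSeq _ _
    obtain ⟨u, hu, hlim⟩ := mem_closure_iff_seq_limit.1 hcl
    have hpt : ∀ x, Filter.Tendsto (fun n => clamp01 (u n x) * w x) Filter.atTop
        (𝓝 (ψ x * w x)) := fun x => by
      have h2 : Filter.Tendsto (fun n => u n x) Filter.atTop (𝓝 (ψ x)) :=
        ((continuous_eval_const (F := C(X, ℝ)) x).tendsto _).comp hlim
      have h3 := (continuous_clamp01.tendsto (ψ x)).comp h2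
      rw [clamp01_of_mem (h0 x) (h1 x)] at h3
      exact h3.mul_const _
    have hconv : ∀ (m : Measure X) [IsFiniteMeasure m],
        Filter.Tendsto (fun n => ∫ x, clamp01 (u n x) * w x ∂m) Filter.atTop
          (𝓝 (∫ x, ψ x * w x ∂m)) := fun m _ => by
      refine tendsto_integral_of_dominated_convergence (fun _ => 1) (fun n => ?_)
        (integrable_const _) (fun n => Filter.Eventually.of_forall fun x => ?_)
        (Filter.Eventually.of_forall hpt)
      · exact ((continuous_clamp01.comp (u n).continuous).mul hw).measurable.aestronglyMeasurable
      · rw [Real.norm_of_nonneg (mul_nonneg (clamp01_nonneg _) (hw0 x).le)]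
        exact mul_le_one₀ (clamp01_le_one _) (hw0 x).le (hw1 x)
    have heq : (fun n => ∫ x, clamp01 (u n x) * w x ∂μ) =
        fun n => ∫ x, clamp01 (u n x) * w x ∂ν := by
      funext n
      obtain ⟨m, hm⟩ := hu n
      rw [← hm]
      exact h m
    have hμ := hconv μ
    rw [heq] at hμ
    exact tendsto_nhds_unique hμ (hconv ν)
  have hfm := isFiniteMeasure_withDensity_unit (μ := μ) hw1
  have hfn := isFiniteMeasure_withDensity_unit (μ := ν) hw1
  have hdens : μ.withDensity (fun x => ENNReal.ofReal (w x)) =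
      ν.withDensity (fun x => ENNReal.ofReal (w x)) := by
    refine ext_of_forall_integral_eq_of_IsFiniteMeasure fun φ => ?_
    rw [integral_withDensity_ofReal hw.measurable (fun x => (hw0 x).le),
      integral_withDensity_ofReal hw.measurable (fun x => (hw0 x).le)]
    set M := ‖φ‖ + 1 with hM
    have hMpos : 0 < M := by positivity
    have hb : ∀ x, |φ x| ≤ M := fun x => (φ.norm_coe_le_norm x).trans (by linarith)
    have hψc : Continuous fun x => (φ x / M + 1) / 2 := by fun_prop
    have hψ0 : ∀ x, 0 ≤ (φ x / M + 1) / 2 := fun x => by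
      have : -1 ≤ φ x / M := by
        rw [le_div_iff₀ hMpos]
        linarith [(abs_le.1 (hb x)).1]
      linarith
    have hψ1 : ∀ x, (φ x / M + 1) / 2 ≤ 1 := fun x => by
      have : φ x / M ≤ 1 := by
        rw [div_le_iff₀ hMpos]
        linarith [(abs_le.1 (hb x)).2]
      linarith
    have hone := key (fun _ => 1) continuous_const (fun _ => zero_le_one) (fun _ => le_rfl)
    have hψ := key _ hψc hψ0 hψ1
    have hrew : ∀ x, w x * φ x =
        2 * M * ((φ x / M + 1) / 2 * w x) - M * (1 * w x) := fun x => by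
      field_simp
      ring
    have hint : ∀ (m : Measure X) [IsFiniteMeasure m], ∫ x, w x * φ x ∂m =
        2 * M * (∫ x, (φ x / M + 1) / 2 * w x ∂m) - M * ∫ x, 1 * w x ∂m := fun m _ => by
      simp_rw [hrew]
      rw [integral_sub, integral_const_mul, integral_const_mul]
      · refine (integrable_of_mem_unit (hψc.mul hw)
          (fun x => mul_nonneg (hψ0 x) (hw0 x).le)
          (fun x => mul_le_one₀ (hψ1 x) (hw0 x).le (hw1 x))).const_mul _
      · refine (integrable_of_mem_unit (continuous_const.mul hw)
          (fun x => mul_nonneg zero_le_one (hw0 x).le)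
          (fun x => mul_le_one₀ le_rfl (hw0 x).le (hw1 x))).const_mul _
    rw [hint μ, hint ν, hone, hψ]
  have hm : Measurable fun x => ENNReal.ofReal (w x) := hw.measurable.ennreal_ofReal
  have hinv : ∀ m : Measure X, (m.withDensity fun x => ENNReal.ofReal (w x)).withDensity
      (fun x => (ENNReal.ofReal (w x))⁻¹) = m := fun m =>
    withDensity_inv_same hm
      (Filter.Eventually.of_forall fun x => (ENNReal.ofReal_pos.2 (hw0 x)).ne')
      (Filter.Eventually.of_forall fun x => ENNReal.ofReal_ne_top)
  rw [← hinv μ, ← hinv ν, hdens]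

/-! ### Moments determine finite measures on the Hilbert cube -/

/-- The coordinates of the Hilbert cube, as bounded continuous functions. -/
def cubeCoord (j : ℕ) : BoundedContinuousFunction (ℕ → unitInterval) ℝ :=
  BoundedContinuousFunction.mkOfCompact
    ⟨fun x => (x j : ℝ), continuous_subtype_val.comp (continuous_apply j)⟩

lemma exists_monomial {φ : BoundedContinuousFunction (ℕ → unitInterval) ℝ}
    (h : φ ∈ Submonoid.closure (Set.range cubeCoord)) :
    ∃ (m : ℕ) (s : Fin m → ℕ), ∀ x, φ x = ∏ i, (x (s i) : ℝ) := by
  induction h using Submonoid.closure_induction with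
  | mem φ hφ =>
    obtain ⟨j, rfl⟩ := hφ
    exact ⟨1, fun _ => j, fun x => by simp [cubeCoord]⟩
  | one => exact ⟨0, Fin.elim0, fun x => by simp⟩
  | mul φ ψ _ _ hφ hψ =>
    obtain ⟨m, s, hs⟩ := hφ
    obtain ⟨n, t, ht⟩ := hψ
    refine ⟨m + n, Fin.append s t, fun x => ?_⟩
    rw [BoundedContinuousFunction.coe_mul, Pi.mul_apply, hs, ht, Fin.prod_univ_add]
    simp

lemma measure_cube_ext {P Q : Measure (ℕ → unitInterval)} [IsFiniteMeasure P] [IsFiniteMeasure Q]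
    (h : ∀ (m : ℕ) (s : Fin m → ℕ), ∫ x, ∏ i, (x (s i) : ℝ) ∂P = ∫ x, ∏ i, (x (s i) : ℝ) ∂Q) :
    P = Q := by
  let A : StarSubalgebra ℝ (BoundedContinuousFunction (ℕ → unitInterval) ℝ) :=
    { Algebra.adjoin ℝ (Set.range cubeCoord) with
      star_mem' := fun {φ} hφ => by
        have : star φ = φ := by
          ext x
          simp
        rw [this]
        exact hφ }
  refine ext_of_forall_mem_subalgebra_integral_eq_of_polish (𝕜 := ℝ) (A := A) ?_ ?_
  · intro x y hxy
    obtain ⟨j, hj⟩ := Function.ne_iff.1 hxy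
    refine ⟨fun z => (z j : ℝ), ⟨(cubeCoord j).toContinuousMap, ?_, rfl⟩, ?_⟩
    · exact ⟨cubeCoord j, Algebra.subset_adjoin ⟨j, rfl⟩, rfl⟩
    · exact fun he => hj (Subtype.ext he)
  · intro φ hφ
    have hspan : φ ∈ Submodule.span ℝ
        (Submonoid.closure (Set.range cubeCoord) : Set (BoundedContinuousFunction _ ℝ)) := by
      rw [← Algebra.adjoin_eq_span]
      exact hφ
    clear hφ
    induction hspan using Submodule.span_induction with
    | mem φ hφ =>
      obtain ⟨m, s, hs⟩ := exists_monomial hφ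
      simp_rw [hs]
      exact h m s
    | zero => simp
    | add φ ψ _ _ hφ hψ =>
      simp only [BoundedContinuousFunction.coe_add, Pi.add_apply]
      rw [integral_add (φ.integrable _) (ψ.integrable _),
        integral_add (φ.integrable _) (ψ.integrable _), hφ, hψ]
    | smul a φ _ hφ =>
      simp only [BoundedContinuousFunction.coe_smul]
      rw [integral_smul, integral_smul, hφ]


/-! ### A collection is determined by its functionals -/

section Palm

variable {d : ℕ}

lemma continuous_shift_neg (q : E d × E d) : Continuous fun u : E d => shift (-u) q := by
  unfold shift
  fun_prop

/-- The image of a sub-probability measure under a diagonal translation. -/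
def SubProb.translate (x : E d) (α : SubProb d) : SubProb d :=
  ⟨α.1.map (shift x), by
    rw [Measure.map_apply (measurable_shift x) MeasurableSet.univ, Set.preimage_univ]
    exact α.2⟩

lemma orbitOf_translate (x : E d) (α : SubProb d) : orbitOf (α.translate x) = orbitOf α :=
  (Quotient.sound (s := subProbSetoid d) ⟨x, rfl⟩ : orbitOf α = orbitOf (α.translate x)).symm

/-- The integral of `g` against `α` seen from the point `(u, u)`. -/
def localAvg (g : E d × E d → ℝ) (α : SubProb d) (u : E d) : ℝ :=
  ∫ q, g (shift (-u) q) ∂α.1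

lemma localAvg_eq (g : E d × E d → ℝ) (hg : Continuous g) (α : SubProb d) (u : E d) :
    localAvg g α u = ∫ q, g q ∂(α.translate (-u)).1 :=
  (integral_map (measurable_shift (-u)).aemeasurable hg.measurable.aestronglyMeasurable).symm

variable {g : E d × E d → ℝ} (hg : Continuous g) (h0 : ∀ q, 0 ≤ g q) (h1 : ∀ q, g q ≤ 1)
  (α : SubProb d)

include h0 in
lemma localAvg_nonneg (u : E d) : 0 ≤ localAvg g α u :=
  integral_nonneg fun _ => h0 _

include hg h0 h1 in
lemma localAvg_le_one (u : E d) : localAvg g α u ≤ 1 := by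
  have : localAvg g α u ≤ ∫ _, (1 : ℝ) ∂α.1 :=
    integral_mono (integrable_of_mem_unit (hg.comp (continuous_shift _)) (fun _ => h0 _)
      fun _ => h1 _) (integrable_const _) fun _ => h1 _
  refine this.trans ?_
  simpa using α.real_univ_le_one

include hg h0 h1 in
lemma continuous_localAvg : Continuous (localAvg g α) := by
  refine continuous_of_dominated (bound := fun _ => 1)
    (fun u => (hg.comp (continuous_shift _)).measurable.aestronglyMeasurable)
    (fun u => Filter.Eventually.of_forall fun q => ?_) (integrable_const _)
    (Filter.Eventually.of_forall fun q => hg.comp (continuous_shift_neg q))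
  rw [Real.norm_of_nonneg (h0 _)]
  exact h1 _

end Palm

section PalmFn

variable {d m : ℕ}

/-- The test function `h(v₀ - u₀) ∏ᵢ Gᵢ(uᵢ - u₀, vᵢ - u₀)`, where `h` is positive and decays, and
where the functions `Gᵢ` are dominated by a function that decays. -/
def palmFn (hm : 1 ≤ m) (G : Fin m → E d × E d → ℝ) (hG : ∀ i, Continuous (G i))
    (h0 : ∀ i q, 0 ≤ G i q) (h1 : ∀ i q, G i q ≤ decay q) : TestFn d (m + 1) where
  toFun y := decay (y (Sum.inr 0) - y (Sum.inl 0)) *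
    ∏ i : Fin m, G i (y (Sum.inl i.succ) - y (Sum.inl 0), y (Sum.inr i.succ) - y (Sum.inl 0))
  continuous' := by
    refine (continuous_decay.comp (by fun_prop)).mul (continuous_finsetProd _ fun i _ => ?_)
    exact (hG i).comp (by fun_prop)
  invariant' a y := by simp
  vanishing' ε hε := by
    refine ⟨2 * (1 / ε), fun y ⟨a, b, _, hab⟩ => ?_⟩
    have hε1 : 0 < 1 / ε := by positivity
    obtain ⟨c, hc⟩ : ∃ c, 1 / ε < ‖y c - y (Sum.inl 0)‖ := by
      by_contra hcon
      push Not at hcon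
      have h2 : dist (y a) (y b) ≤ dist (y a) (y (Sum.inl 0)) + dist (y b) (y (Sum.inl 0)) :=
        dist_triangle_right _ _ _
      rw [dist_eq_norm (y a) (y (Sum.inl 0)), dist_eq_norm (y b) (y (Sum.inl 0))] at h2
      linarith [hcon a, hcon b]
    have hle1 : ∀ i q, G i q ≤ 1 := fun i q => (h1 i q).trans (decay_le_one q)
    have hdec0 := (decay_pos (y (Sum.inr 0) - y (Sum.inl 0))).le
    have hdec1 := decay_le_one (y (Sum.inr 0) - y (Sum.inl 0))
    have hprod0 : 0 ≤ ∏ i : Fin m,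
        G i (y (Sum.inl i.succ) - y (Sum.inl 0), y (Sum.inr i.succ) - y (Sum.inl 0)) :=
      Finset.prod_nonneg fun i _ => h0 i _
    rw [abs_of_nonneg (mul_nonneg hdec0 hprod0)]
    have hprodle : ∀ j : Fin m, ∏ i : Fin m,
        G i (y (Sum.inl i.succ) - y (Sum.inl 0), y (Sum.inr i.succ) - y (Sum.inl 0)) ≤
        G j (y (Sum.inl j.succ) - y (Sum.inl 0), y (Sum.inr j.succ) - y (Sum.inl 0)) := fun j => by
      rw [← Finset.mul_prod_erase _ _ (Finset.mem_univ j)]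
      exact mul_le_of_le_one_right (h0 j _)
        (Finset.prod_le_one (fun i _ => h0 i _) fun i _ => hle1 i _)
    have hfactor : ∀ j : Fin m,
        1 / ε < ‖(y (Sum.inl j.succ) - y (Sum.inl 0), y (Sum.inr j.succ) - y (Sum.inl 0))‖ →
        decay (y (Sum.inr 0) - y (Sum.inl 0)) * ∏ i : Fin m,
          G i (y (Sum.inl i.succ) - y (Sum.inl 0), y (Sum.inr i.succ) - y (Sum.inl 0)) < ε :=
      fun j hj => ((mul_le_of_le_one_left hprod0 hdec1).trans
        ((hprodle j).trans (h1 j _))).trans_lt (decay_lt hε hj)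
    rcases c with c | c
    · induction c using Fin.cases with
      | zero =>
        rw [sub_self, norm_zero] at hc
        exact absurd hc (not_lt.2 hε1.le)
      | succ j => exact hfactor j (hc.trans_le (le_max_left _ _))
    · induction c using Fin.cases with
      | zero =>
        refine (mul_le_of_le_one_right hdec0 ?_).trans_lt (decay_lt hε hc)
        exact (hprodle ⟨0, hm⟩).trans (hle1 _ _)
      | succ j => exact hfactor j (hc.trans_le (le_max_right _ _))

/-- Integrating out all the points but the first one leaves a product of integrals against `α` seen
from the first point. -/
lemma Lam_palmFn (hm : 1 ≤ m) (G : Fin m → E d × E d → ℝ) (hG : ∀ i, Continuous (G i))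
    (h0 : ∀ i q, 0 ≤ G i q) (h1 : ∀ i q, G i q ≤ decay q) (α : SubProb d) :
    Lam (palmFn hm G hG h0 h1) α =
      ∫ p, decay (p.2 - p.1) * ∏ i, localAvg (G i) α p.1 ∂α.1 := by
  have hint := integrable_testFn (by omega) (palmFn hm G hG h0 h1)
    (Measure.pi fun _ : Fin (m + 1) => α.1)
  have hmp := (measurePreserving_piFinSuccAbove (fun _ : Fin (m + 1) => α.1) 0).symm
  unfold Lam
  rw [← hmp.integral_comp' (g := fun p => (palmFn hm G hG h0 h1).toFun (coords p))]
  have hint' := (hmp.integrable_comp_emb (MeasurableEquiv.measurableEmbedding _)).2 hint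
  simp only [Function.comp_def] at hint'
  rw [integral_prod _ hint']
  refine integral_congr_ae (Filter.Eventually.of_forall fun p => ?_)
  change ∫ q : Fin m → E d × E d, (palmFn hm G hG h0 h1).toFun
      (coords ((MeasurableEquiv.piFinSuccAbove (fun _ => E d × E d) 0).symm (p, q)))
        ∂(Measure.pi fun _ : Fin m => α.1) = _
  have hfun : ∀ q : Fin m → E d × E d, (palmFn hm G hG h0 h1).toFun
      (coords ((MeasurableEquiv.piFinSuccAbove (fun _ => E d × E d) 0).symm (p, q))) =
      decay (p.2 - p.1) * ∏ i, G i (shift (-p.1) (q i)) := fun q => by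
    simp [palmFn, coords, MeasurableEquiv.piFinSuccAbove, shift, sub_eq_add_neg, Fin.insertNthEquiv]
  simp_rw [hfun]
  rw [integral_const_mul]
  congr 1
  exact integral_fintype_prod_eq_prod (fun i q => G i (shift (-p.1) q))

end PalmFn


section Separation

variable {d : ℕ}

lemma continuous_diff_decay : Continuous fun p : E d × E d => decay (p.2 - p.1) :=
  continuous_decay.comp (by fun_prop)

/-- The weight of a point `p = (u, v)` in the Palm measure: `h(v - u)` times the mass of `α` near
`(u, u)`, counted with a decaying weight. -/
def palmWeight (α : SubProb d) (p : E d × E d) : ℝ :=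
  decay (p.2 - p.1) * localAvg decay α p.1

lemma continuous_palmWeight (α : SubProb d) : Continuous (palmWeight α) :=
  continuous_diff_decay.mul
    ((continuous_localAvg continuous_decay (fun q => (decay_pos q).le) decay_le_one α).comp
      continuous_fst)

lemma palmWeight_nonneg (α : SubProb d) (p : E d × E d) : 0 ≤ palmWeight α p :=
  mul_nonneg (decay_pos _).le (localAvg_nonneg (fun q => (decay_pos q).le) α _)

lemma palmWeight_le_one (α : SubProb d) (p : E d × E d) : palmWeight α p ≤ 1 :=
  mul_le_one₀ (decay_le_one _) (localAvg_nonneg (fun q => (decay_pos q).le) α _)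
    (localAvg_le_one continuous_decay (fun q => (decay_pos q).le) decay_le_one α _)

lemma palmWeight_pos (α : SubProb d) (hα : α.1 ≠ 0) (p : E d × E d) : 0 < palmWeight α p := by
  refine mul_pos (decay_pos _) ?_
  unfold localAvg
  have hint : Integrable (fun q => decay (shift (-p.1) q)) α.1 :=
    integrable_of_mem_unit (continuous_decay.comp (continuous_shift _))
      (fun q => (decay_pos _).le) fun q => decay_le_one _
  rw [integral_pos_iff_support_of_nonneg (fun q => (decay_pos _).le) hint]
  have : (Function.support fun q => decay (shift (-p.1) q)) = Set.univ :=
    Set.eq_univ_of_forall fun q => (decay_pos _).ne'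
  rw [this]
  exact Measure.measure_univ_pos.2 hα

/-- Two collections with the same functionals are equal: they have the same Palm measure, and the
multiplicity of an orbit can be read off from the mass of the set of its views. -/
lemma Collection.ext_of_sumLam {ξ η : Collection d}
    (h : ∀ (k : ℕ) (_ : 2 ≤ k) (f : TestFn d k), ξ.sumLam f = η.sumLam f) : ξ = η := by
  obtain ⟨c, hc, hc0, hc1, hdet⟩ := exists_determining (E d × E d) decay continuous_decay
    decay_pos decay_le_one
  let g : ℕ → E d × E d → ℝ := fun j q => c j q * decay q
  have hg : ∀ j, Continuous (g j) := fun j => (hc j).mul continuous_decay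
  have hg0 : ∀ j q, 0 ≤ g j q := fun j q => mul_nonneg (hc0 j q) (decay_pos q).le
  have hgd : ∀ j q, g j q ≤ decay q := fun j q =>
    mul_le_of_le_one_left (decay_pos q).le (hc1 j q)
  have hg1 : ∀ j q, g j q ≤ 1 := fun j q => (hgd j q).trans (decay_le_one q)
  -- the measure `α` seen from the point `u`, encoded by its integrals
  let Ψ : SubProb d → E d → ℕ → unitInterval := fun α u j =>
    ⟨localAvg (g j) α u, localAvg_nonneg (hg0 j) α u,
      localAvg_le_one (hg j) (hg0 j) (hg1 j) α u⟩
  have hΨ : ∀ α, Continuous (Ψ α) := fun α => continuous_pi fun j =>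
    (continuous_localAvg (hg j) (hg0 j) (hg1 j) α).subtype_mk _
  have hΨinj : ∀ α β u u', Ψ α u = Ψ β u' → orbitOf α = orbitOf β := fun α β u u' he => by
    rw [← orbitOf_translate (-u) α, ← orbitOf_translate (-u') β]
    congr 1
    refine Subtype.ext (hdet _ _ fun j => ?_)
    have h1 : localAvg (g j) α u = localAvg (g j) β u' := congrArg Subtype.val (congrFun he j)
    rwa [localAvg_eq _ (hg j), localAvg_eq _ (hg j)] at h1
  let rep : Orbit d → SubProb d := fun o => Quotient.out o
  have hrep : ∀ o, orbitOf (rep o) = o := fun o => Quotient.out_eq _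
  let Q : Orbit d → Measure (ℕ → unitInterval) := fun o =>
    ((rep o).1.withDensity fun p => ENNReal.ofReal (palmWeight (rep o) p)).map
      fun p => Ψ (rep o) p.1
  have hΨm : ∀ o, Measurable fun p : E d × E d => Ψ (rep o) p.1 := fun o =>
    ((hΨ _).comp continuous_fst).measurable
  have hQfin : ∀ o, IsFiniteMeasure (Q o) := fun o => by
    have := isFiniteMeasure_withDensity_unit (μ := (rep o).1) (palmWeight_le_one (rep o))
    exact Measure.isFiniteMeasure_map _ _
  have hQmass : ∀ o, Q o Set.univ ≤ o.mass := fun o => by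
    rw [Measure.map_apply (hΨm o) MeasurableSet.univ, Set.preimage_univ,
      withDensity_apply _ MeasurableSet.univ, setLIntegral_univ]
    calc ∫⁻ p, ENNReal.ofReal (palmWeight (rep o) p) ∂(rep o).1 ≤ ∫⁻ _, 1 ∂(rep o).1 :=
          lintegral_mono fun p => ENNReal.ofReal_le_one.2 (palmWeight_le_one _ p)
      _ = (orbitOf (rep o)).mass := by rw [lintegral_one, mass_orbitOf]
      _ = o.mass := by rw [hrep]
  let P : Collection d → Measure (ℕ → unitInterval) := fun ζ =>
    Measure.sum fun o => (ζ.mult o : ENNReal) • Q o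
  have hPfin : ∀ ζ, IsFiniteMeasure (P ζ) := fun ζ => ⟨by
    rw [Measure.sum_apply _ MeasurableSet.univ]
    refine lt_of_le_of_lt (ENNReal.tsum_le_tsum fun o => ?_)
      (ζ.mass_le_one.trans_lt ENNReal.one_lt_top)
    rw [Measure.smul_apply, smul_eq_mul]
    gcongr
    exact hQmass o⟩
  have hPint : ∀ ζ (m : ℕ) (s : Fin m → ℕ), ∫ x, ∏ i, (x (s i) : ℝ) ∂(P ζ) =
      ζ.sumLam (palmFn (m := m + 1) (by omega) (Fin.cons decay fun i => g (s i))
        (Fin.cases continuous_decay fun i => hg (s i))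
        (Fin.cases (fun q => (decay_pos q).le) fun i => hg0 (s i))
        (Fin.cases (fun q => le_rfl) fun i => hgd (s i))) := fun ζ m s => by
    have := hPfin ζ
    have hcont : Continuous fun x : ℕ → unitInterval => ∏ i, (x (s i) : ℝ) := by fun_prop
    have hint : Integrable (fun x : ℕ → unitInterval => ∏ i, (x (s i) : ℝ)) (P ζ) :=
      integrable_of_mem_unit hcont (fun x => Finset.prod_nonneg fun i _ => (x (s i)).2.1)
        fun x => Finset.prod_le_one (fun i _ => (x (s i)).2.1) fun i _ => (x (s i)).2.2
    rw [integral_sum_measure hint]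
    refine tsum_congr fun o => ?_
    rw [integral_smul_measure, smul_eq_mul, ENNReal.toReal_natCast, Collection.term]
    congr 1
    rw [integral_map (hΨm o).aemeasurable hcont.measurable.aestronglyMeasurable,
      integral_withDensity_ofReal (continuous_palmWeight _).measurable (palmWeight_nonneg _)]
    conv_rhs => rw [← hrep o, Lam_orbitOf, Lam_palmFn]
    refine integral_congr_ae (Filter.Eventually.of_forall fun p => ?_)
    simp only [Fin.prod_univ_succ, Fin.cons_zero, Fin.cons_succ, palmWeight, Ψ, mul_assoc]
  have hPeq : P ξ = P η := by
    have := hPfin ξ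
    have := hPfin η
    refine measure_cube_ext fun m s => ?_
    rw [hPint, hPint]
    exact h _ (by omega) _
  have hmult : ∀ o, ξ.mult o = η.mult o := fun o => by
    by_cases ho : o.mass = 0
    · rw [ξ.mult_of_mass_eq_zero o ho, η.mult_of_mass_eq_zero o ho]
    -- the set of all views of the orbit `o` carries exactly the part of `P` that comes from `o`
    let S : Set (ℕ → unitInterval) := Set.range (Ψ (rep o))
    have hS : MeasurableSet S := by
      have hU : S = ⋃ n : ℕ, Ψ (rep o) '' Metric.closedBall 0 n := by
        rw [← Set.image_iUnion, Metric.iUnion_closedBall_nat, Set.image_univ]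
      rw [hU]
      exact MeasurableSet.iUnion fun n =>
        ((isCompact_closedBall _ _).image (hΨ _)).isClosed.measurableSet
    have hQne : ∀ o', o' ≠ o → Q o' S = 0 := fun o' hne => by
      rw [Measure.map_apply (hΨm o') hS]
      have : (fun p : E d × E d => Ψ (rep o') p.1) ⁻¹' S = ∅ := by
        refine Set.eq_empty_of_forall_notMem fun p hp => hne ?_
        obtain ⟨u, hu⟩ := hp
        rw [← hrep o', ← hrep o]
        exact (hΨinj _ _ _ _ hu).symm
      rw [this, measure_empty]
    have hQpos : Q o S ≠ 0 := by
      rw [Measure.map_apply (hΨm o) hS]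
      have : (fun p : E d × E d => Ψ (rep o) p.1) ⁻¹' S = Set.univ :=
        Set.eq_univ_of_forall fun p => ⟨p.1, rfl⟩
      rw [this, withDensity_apply _ MeasurableSet.univ, setLIntegral_univ]
      have hne : (rep o).1 ≠ 0 := fun h0 => ho (by rw [← hrep o, mass_orbitOf, h0]; simp)
      rw [← pos_iff_ne_zero,
        lintegral_pos_iff_support (continuous_palmWeight _).measurable.ennreal_ofReal]
      have : (Function.support fun p => ENNReal.ofReal (palmWeight (rep o) p)) = Set.univ :=
        Set.eq_univ_of_forall fun p => (ENNReal.ofReal_pos.2 (palmWeight_pos _ hne p)).ne'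
      rw [this]
      exact Measure.measure_univ_pos.2 hne
    have hPS : ∀ ζ, P ζ S = (ζ.mult o : ENNReal) * Q o S := fun ζ => by
      rw [Measure.sum_apply _ hS, tsum_eq_single o fun o' hne => by
        rw [Measure.smul_apply, hQne o' hne, smul_zero], Measure.smul_apply, smul_eq_mul]
    have he : (ξ.mult o : ENNReal) * Q o S = (η.mult o : ENNReal) * Q o S := by
      rw [← hPS, ← hPS, hPeq]
    have := hQfin o
    exact_mod_cast (ENNReal.mul_left_inj hQpos (measure_ne_top _ _)).1 he
  cases ξ
  cases η
  congr
  exact funext hmult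

end Separation


/-! ### Density of the single orbits of probability measures -/

section Single

variable {d : ℕ}

/-- The collection whose only member is the orbit of `α`. -/
def single (α : SubProb d) : Collection d :=
  ofFamily (fun _ : Unit => orbitOf α) (by simpa using (orbitOf α).mass_le_one)

lemma sumLam_single {k : ℕ} (hk : 1 ≤ k) (f : TestFn d k) (α : SubProb d) :
    (single α).sumLam f = Lam f α := by
  rw [single, sumLam_ofFamily hk]
  simp [Lam_orbitOf]

lemma single_mem_probOrbits {α : SubProb d} (hα : α.1 Set.univ = 1) :
    single α ∈ probOrbits d := by
  have hm : (orbitOf α).mass ≠ 0 := by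
    rw [mass_orbitOf, hα]
    exact one_ne_zero
  refine ⟨α, hα, ?_, fun o ho => ?_⟩
  · change familyMult _ _ = 1
    rw [familyMult, if_neg hm]
    simp
  · change familyMult _ _ = 0
    rw [familyMult]
    split_ifs
    · rfl
    · have : IsEmpty {_i : Unit // orbitOf α = o} := ⟨fun i => ho i.2.symm⟩
      exact Nat.card_of_isEmpty

end Single

lemma Lam_map {d k : ℕ} {Ω : Type*} [MeasurableSpace Ω] (A : Measure Ω) [IsFiniteMeasure A]
    {T : Ω → E d × E d} (hT : Measurable T) (f : TestFn d k) (β : SubProb d)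
    (hβ : β.1 = A.map T) :
    Lam f β = ∫ a : Fin k → Ω, f.toFun (coords fun i => T (a i)) ∂(Measure.pi fun _ => A) := by
  have : IsFiniteMeasure (A.map T) := hβ ▸ isFiniteMeasure_subProb β
  have hpi : (Measure.pi fun _ : Fin k => β.1) =
      (Measure.pi fun _ : Fin k => A).map (fun a i => T (a i)) := by
    rw [hβ]
    exact (Measure.pi_map_pi (μ := fun _ : Fin k => A) (f := fun _ => T)
      (fun _ => hT.aemeasurable)).symm
  unfold Lam
  rw [hpi, integral_map]
  · exact (measurable_pi_lambda _ fun i => hT.comp (measurable_pi_apply i)).aemeasurable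
  · exact (f.continuous'.comp continuous_coords).aestronglyMeasurable

section Density

variable {d : ℕ}

/-- The measure on `ℕ × (ℝ^d × ℝ^d)` that puts a copy of `α j` at the label `j + 1`, and the
missing mass at the label `0`. -/
def labelled (α : ℕ → SubProb d) : Measure (ℕ × E d × E d) :=
  Measure.sum (fun j => (α j).1.map (Prod.mk (j + 1))) +
    (1 - ∑' j, (α j).1 Set.univ) • Measure.dirac (0, 0)

lemma labelled_univ {α : ℕ → SubProb d} (h : ∑' j, (α j).1 Set.univ ≤ 1) :
    labelled α Set.univ = 1 := by
  rw [labelled, Measure.add_apply, Measure.sum_apply _ MeasurableSet.univ]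
  have : ∀ j, (α j).1.map (Prod.mk (j + 1)) Set.univ = (α j).1 Set.univ := fun j => by
    rw [Measure.map_apply measurable_prodMk_left MeasurableSet.univ, Set.preimage_univ]
  simp_rw [this]
  simp only [Measure.smul_apply, measure_univ, smul_eq_mul, mul_one]
  exact add_tsub_cancel_of_le h

lemma labelled_restrict (α : ℕ → SubProb d) (j : ℕ) :
    (labelled α).restrict ({j + 1} ×ˢ Set.univ) = (α j).1.map (Prod.mk (j + 1)) := by
  have hm : MeasurableSet (({j + 1} : Set ℕ) ×ˢ (Set.univ : Set (E d × E d))) :=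
    (measurableSet_singleton _).prod MeasurableSet.univ
  ext s hs
  rw [Measure.restrict_apply hs, labelled, Measure.add_apply, Measure.sum_apply _ (hs.inter hm),
    tsum_eq_single j]
  · have h1 : (Measure.dirac ((0, 0) : ℕ × E d × E d)) (s ∩ {j + 1} ×ˢ Set.univ) = 0 := by
      rw [Measure.dirac_apply' _ (hs.inter hm)]
      simp
    rw [Measure.smul_apply, h1, smul_zero, add_zero,
      Measure.map_apply measurable_prodMk_left (hs.inter hm),
      Measure.map_apply measurable_prodMk_left hs]
    congr 1
    ext p
    simp
  · intro i hi
    rw [Measure.map_apply measurable_prodMk_left (hs.inter hm)]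
    convert measure_empty (μ := (α i).1)
    ext p
    simp [hi]

/-- The map that spreads the labels far apart: the label `0` goes to a pair of points at distance
`n`, and the copy with the label `j` is translated by `n j e`. -/
def spread (e : E d) (n : ℕ) (a : ℕ × E d × E d) : E d × E d :=
  if a.1 = 0 then (0, (n : ℝ) • e) else shift (((n : ℝ) * a.1) • e) a.2

lemma measurable_spread (e : E d) (n : ℕ) : Measurable (spread e n) := by
  refine measurable_from_prod_countable_right fun j => ?_
  unfold spread
  by_cases hj : j = 0
  · simp [hj]
  · simp only [hj, if_false]
    exact measurable_shift _

lemma TestFn.tendsto_zero_of_dist {k : ℕ} (f : TestFn d k) {y : ℕ → Fin k ⊕ Fin k → E d}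
    {a b : Fin k ⊕ Fin k} (hab : a ≠ b) (C : ℝ) (h : ∀ n : ℕ, n - C ≤ dist (y n a) (y n b)) :
    Filter.Tendsto (fun n => f.toFun (y n)) Filter.atTop (𝓝 0) := by
  refine Metric.tendsto_atTop.2 fun ε hε => ?_
  obtain ⟨R, hR⟩ := f.vanishing' ε hε
  obtain ⟨N, hN⟩ := exists_nat_gt (R + C)
  refine ⟨N, fun n hn => ?_⟩
  rw [Real.dist_eq, sub_zero]
  refine hR _ ⟨a, b, hab, ?_⟩
  have : (N : ℝ) ≤ n := Nat.cast_le.2 hn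
  linarith [h n]

/-- The configurations of `k` labelled points whose labels are all equal to `j + 1`. -/
def sameLabel (k j : ℕ) : Set (Fin k → ℕ × E d × E d) :=
  Set.univ.pi fun _ => {j + 1} ×ˢ Set.univ

lemma mem_sameLabel {k j : ℕ} {a : Fin k → ℕ × E d × E d} :
    a ∈ sameLabel k j ↔ ∀ l, (a l).1 = j + 1 := by
  simp [sameLabel, Set.mem_pi]

lemma measurableSet_sameLabel (k j : ℕ) : MeasurableSet (sameLabel (d := d) k j) :=
  MeasurableSet.univ_pi fun _ => (measurableSet_singleton _).prod MeasurableSet.univ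

lemma tendsto_spread {e : E d} (he : ‖e‖ = 1) {k : ℕ} (hk : 1 ≤ k) (f : TestFn d k)
    (a : Fin k → ℕ × E d × E d) :
    Filter.Tendsto (fun n => f.toFun (coords fun i => spread e n (a i))) Filter.atTop
      (𝓝 ((⋃ j, sameLabel k j).indicator (fun a => f.toFun (coords fun i => (a i).2)) a)) := by
  by_cases ha : a ∈ ⋃ j, sameLabel k j
  · rw [Set.indicator_of_mem ha]
    obtain ⟨j, hj⟩ := Set.mem_iUnion.1 ha
    rw [mem_sameLabel] at hj
    refine tendsto_const_nhds.congr fun n => ?_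
    rw [← f.invariant' (((n : ℝ) * (j + 1 : ℕ)) • e)]
    congr 1
    funext i
    rcases i with i | i <;> simp [coords, spread, hj i, shift]
  · rw [Set.indicator_of_notMem ha]
    by_cases h0 : ∃ l, (a l).1 = 0
    · obtain ⟨l, hl⟩ := h0
      refine f.tendsto_zero_of_dist (a := Sum.inl l) (b := Sum.inr l) (by simp) 0 fun n => ?_
      simp [coords, spread, hl, norm_smul, he]
    · push Not at h0
      obtain ⟨l, l', hll⟩ : ∃ l l', (a l).1 ≠ (a l').1 := by
        by_contra hcon
        push Not at hcon
        obtain ⟨j, hj⟩ := Nat.exists_eq_succ_of_ne_zero (h0 ⟨0, hk⟩)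
        exact ha (Set.mem_iUnion.2 ⟨j, mem_sameLabel.2 fun l => (hcon l ⟨0, hk⟩).trans hj⟩)
      refine f.tendsto_zero_of_dist (a := Sum.inl l) (b := Sum.inl l')
        (fun h => hll (by rw [Sum.inl.inj h])) ‖(a l).2.1 - (a l').2.1‖ fun n => ?_
      have h1 : (coords fun i => spread e n (a i)) (Sum.inl l) =
          (a l).2.1 + ((n : ℝ) * (a l).1) • e := by
        simp [coords, spread, h0 l, shift]
      have h2 : (coords fun i => spread e n (a i)) (Sum.inl l') =
          (a l').2.1 + ((n : ℝ) * (a l').1) • e := by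
        simp [coords, spread, h0 l', shift]
      rw [h1, h2, dist_eq_norm]
      have h3 : (a l).2.1 + ((n : ℝ) * (a l).1) • e - ((a l').2.1 + ((n : ℝ) * (a l').1) • e) =
          ((n : ℝ) * ((a l).1 - (a l').1)) • e + ((a l).2.1 - (a l').2.1) := by
        module
      have h4 : (n : ℝ) ≤ ‖((n : ℝ) * ((a l).1 - (a l').1)) • e‖ := by
        rw [norm_smul, he, mul_one, norm_mul, Real.norm_natCast]
        refine le_mul_of_one_le_right (Nat.cast_nonneg n) ?_
        have h5 : ((a l).1 : ℤ) - (a l').1 ≠ 0 := by omega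
        have h6 := Int.one_le_abs h5
        rw [Real.norm_eq_abs]
        exact_mod_cast h6
      rw [h3]
      have h7 := norm_sub_norm_le (((n : ℝ) * ((a l).1 - (a l').1)) • e)
        (-((a l).2.1 - (a l').2.1))
      rw [sub_neg_eq_add, norm_neg] at h7
      linarith

/-- Every collection is the limit of single orbits of probability measures: the members are put
side by side at larger and larger distances, and the missing mass is placed on a pair of points
whose distance tends to infinity. -/
lemma Collection.exists_prob_tendsto (hd : 0 < d) (ξ : Collection d) :
    ∃ μ : ℕ → SubProb d, (∀ n, (μ n).1 Set.univ = 1) ∧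
      ∀ (k : ℕ) (_ : 2 ≤ k) (f : TestFn d k),
        Filter.Tendsto (fun n => Lam f (μ n)) Filter.atTop (𝓝 (ξ.sumLam f)) := by
  obtain ⟨α, hα, hsum⟩ := ξ.exists_sequence
  let e : E d := EuclideanSpace.single ⟨0, hd⟩ 1
  have he : ‖e‖ = 1 := by simp [e]
  let A := labelled α
  have hA : A Set.univ = 1 := labelled_univ hα
  have : IsProbabilityMeasure A := ⟨hA⟩
  have hmap : ∀ n, A.map (spread e n) Set.univ = 1 := fun n => by
    rw [Measure.map_apply (measurable_spread e n) MeasurableSet.univ, Set.preimage_univ, hA]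
  refine ⟨fun n => ⟨A.map (spread e n), (hmap n).le⟩, hmap, fun k hk f => ?_⟩
  have hk1 : 1 ≤ k := one_le_two.trans hk
  have : Nonempty (Fin k) := ⟨⟨0, hk1⟩⟩
  have hFm : Measurable fun a : Fin k → ℕ × E d × E d => f.toFun (coords fun i => (a i).2) :=
    (f.continuous'.comp continuous_coords).measurable.comp (by fun_prop)
  have hlim : ξ.sumLam f = ∫ a, (⋃ j, sameLabel k j).indicator
      (fun a => f.toFun (coords fun i => (a i).2)) a ∂(Measure.pi fun _ => A) := by
    have hint : Integrable (fun a : Fin k → ℕ × E d × E d => f.toFun (coords fun i => (a i).2))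
        (Measure.pi fun _ => A) :=
      Integrable.of_bound hFm.aestronglyMeasurable f.supNorm
        (Filter.Eventually.of_forall fun a => f.abs_le_supNorm _)
    have hdisj : Pairwise (Function.onFun Disjoint (sameLabel (d := d) k)) := fun i j hij => by
      refine Set.disjoint_left.2 fun a hi hj => hij ?_
      rw [mem_sameLabel] at hi hj
      have := (hi ⟨0, hk1⟩).symm.trans (hj ⟨0, hk1⟩)
      omega
    rw [integral_indicator (MeasurableSet.iUnion fun j => measurableSet_sameLabel k j),
      ← (hasSum_integral_iUnion (measurableSet_sameLabel k) hdisj hint.integrableOn).tsum_eq,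
      hsum k hk1 f]
    refine tsum_congr fun j => ?_
    rw [sameLabel, Measure.restrict_pi_pi]
    simp_rw [show A.restrict ({j + 1} ×ˢ Set.univ) = _ from labelled_restrict α j]
    have hfin : IsFiniteMeasure ((α j).1.map (Prod.mk (j + 1))) :=
      Measure.isFiniteMeasure_map _ _
    refine Lam_map _ measurable_snd f _ ?_
    rw [Measure.map_map measurable_snd measurable_prodMk_left]
    exact Measure.map_id.symm
  rw [hlim]
  have hpre : ∀ n, Lam f (⟨A.map (spread e n), (hmap n).le⟩ : SubProb d) =
      ∫ a : Fin k → ℕ × E d × E d, f.toFun (coords fun i => spread e n (a i))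
        ∂(Measure.pi fun _ => A) := fun n => Lam_map A (measurable_spread e n) f _ rfl
  simp_rw [hpre]
  refine tendsto_integral_of_dominated_convergence (fun _ => f.supNorm) (fun n => ?_)
    (integrable_const _) (fun n => Filter.Eventually.of_forall fun a => f.abs_le_supNorm _)
    (Filter.Eventually.of_forall fun a => tendsto_spread he hk1 f a)
  refine ((f.continuous'.comp continuous_coords).measurable.comp ?_).aestronglyMeasurable
  exact measurable_pi_lambda _ fun i => (measurable_spread e n).comp (measurable_pi_apply i)

end Density


/-! ### Vague limits along an ultrafilter -/

section Vague

variable {d : ℕ}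

lemma exists_tendsto_of_eventually_dist_le (U : Ultrafilter ℕ) {V : Type*} [PseudoMetricSpace V]
    [ProperSpace V] (u : ℕ → V) (v : V) (C : ℝ) (h : ∀ᶠ n in (U : Filter ℕ), dist (u n) v ≤ C) :
    ∃ L, Filter.Tendsto u U (𝓝 L) := by
  obtain ⟨L, -, hL⟩ := (isCompact_closedBall v C).ultrafilter_le_nhds (U.map u)
    (Filter.le_principal_iff.2 h)
  exact ⟨L, hL⟩

/-- A plateau function on `ℝ^d × ℝ^d`: `1` on the ball of radius `R`, and `0` outside the ball of
radius `R + 1`. -/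
def bump (R : ℝ) (p : E d × E d) : ℝ := clamp01 (R + 1 - ‖p‖)

lemma continuous_bump (R : ℝ) : Continuous (bump (d := d) R) :=
  continuous_clamp01.comp (continuous_const.sub continuous_norm)

lemma bump_nonneg (R : ℝ) (p : E d × E d) : 0 ≤ bump R p := clamp01_nonneg _

lemma bump_le_one (R : ℝ) (p : E d × E d) : bump R p ≤ 1 := clamp01_le_one _

lemma bump_eq_one {R : ℝ} {p : E d × E d} (h : ‖p‖ ≤ R) : bump R p = 1 :=
  clamp01_of_one_le (by linarith)

lemma norm_lt_of_bump_ne_zero {R : ℝ} {p : E d × E d} (h : bump R p ≠ 0) : ‖p‖ < R + 1 := by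
  by_contra hcon
  exact h (clamp01_of_nonpos (by linarith))

lemma hasCompactSupport_bump (R : ℝ) : HasCompactSupport (bump (d := d) R) :=
  HasCompactSupport.intro (isCompact_closedBall (0 : E d × E d) (R + 1)) fun p hp => by
    by_contra h
    exact hp (mem_closedBall_zero_iff.2 (norm_lt_of_bump_ne_zero h).le)

/-- Vague convergence of sub-probability measures along an ultrafilter. -/
def VagueTendsto (U : Ultrafilter ℕ) (ν : ℕ → SubProb d) (β : SubProb d) : Prop :=
  ∀ g : E d × E d → ℝ, Continuous g → HasCompactSupport g →
    Filter.Tendsto (fun n => ∫ p, g p ∂(ν n).1) U (𝓝 (∫ p, g p ∂β.1))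

open scoped CompactlySupported in
/-- Sub-probability measures are vaguely compact: the limits of the integrals form a positive
functional, which is represented by a measure. -/
lemma exists_vagueTendsto (U : Ultrafilter ℕ) (ν : ℕ → SubProb d) :
    ∃ β : SubProb d, VagueTendsto U ν β := by
  have hint : ∀ (g : C_c(E d × E d, ℝ)) n, Integrable g (ν n).1 := fun g n =>
    g.continuous.integrable_of_hasCompactSupport g.hasCompactSupport
  have hex : ∀ g : C_c(E d × E d, ℝ), ∃ L, Filter.Tendsto (fun n => ∫ p, g p ∂(ν n).1) U (𝓝 L) :=
    fun g => by
      obtain ⟨C, hC⟩ := g.hasCompactSupport.exists_bound_of_continuous g.continuous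
      refine exists_tendsto_of_eventually_dist_le U _ 0 C (Filter.Eventually.of_forall fun n => ?_)
      rw [dist_zero_right]
      refine (norm_integral_le_of_norm_le_const (Filter.Eventually.of_forall hC)).trans ?_
      exact mul_le_of_le_one_right ((norm_nonneg _).trans (hC 0)) (ν n).real_univ_le_one
  choose L hL using hex
  let Λ : C_c(E d × E d, ℝ) →ₚ[ℝ] ℝ := PositiveLinearMap.mk₀
    { toFun := L
      map_add' := fun f g => by
        refine tendsto_nhds_unique (hL (f + g)) (((hL f).add (hL g)).congr fun n => ?_)
        rw [← integral_add (hint f n) (hint g n)]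
        rfl
      map_smul' := fun a f => by
        refine tendsto_nhds_unique (hL (a • f)) (((hL f).const_smul a).congr fun n => ?_)
        rw [← integral_smul]
        rfl }
    (fun f hf => ge_of_tendsto' (hL f) fun n => integral_nonneg fun p => hf p)
  have hmass : RealRMK.rieszMeasure Λ Set.univ ≤ 1 := by
    have hball : ∀ R : ℕ, RealRMK.rieszMeasure Λ (Metric.closedBall 0 R) ≤ 1 := fun R => by
      let b : C_c(E d × E d, ℝ) := ⟨⟨bump R, continuous_bump R⟩, hasCompactSupport_bump R⟩
      refine (RealRMK.rieszMeasure_le_of_eq_one Λ (f := b) (fun p => bump_nonneg _ p)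
        (isCompact_closedBall _ _) fun p hp => bump_eq_one (mem_closedBall_zero_iff.1 hp)).trans ?_
      refine ENNReal.ofReal_le_one.2 (le_of_tendsto' (hL b) fun n => ?_)
      calc ∫ p, b p ∂(ν n).1 ≤ ∫ _, (1 : ℝ) ∂(ν n).1 :=
            integral_mono (hint b n) (integrable_const _) fun p => bump_le_one _ p
        _ ≤ 1 := by simpa using (ν n).real_univ_le_one
    rw [← Metric.iUnion_closedBall_nat (0 : E d × E d)]
    have hmono : Monotone fun R : ℕ => Metric.closedBall (0 : E d × E d) R := fun a b hab =>
      Metric.closedBall_subset_closedBall (Nat.cast_le.2 hab)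
    rw [hmono.measure_iUnion]
    exact iSup_le hball
  refine ⟨⟨RealRMK.rieszMeasure Λ, hmass⟩, fun g hg hgc => ?_⟩
  have hlim := hL ⟨⟨g, hg⟩, hgc⟩
  rw [show L ⟨⟨g, hg⟩, hgc⟩ = ∫ p, g p ∂(RealRMK.rieszMeasure Λ) from
    (RealRMK.integral_rieszMeasure Λ ⟨⟨g, hg⟩, hgc⟩).symm] at hlim
  exact hlim

lemma integral_translate {g : E d × E d → ℝ} (hg : Continuous g) (x : E d) (α : SubProb d) :
    ∫ p, g p ∂(α.translate x).1 = ∫ p, g (shift x p) ∂α.1 :=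
  integral_map (measurable_shift x).aemeasurable hg.measurable.aestronglyMeasurable

end Vague

/-! ### Convergence of powers of measures -/

section Powers

lemma pi_smul_const {X : Type*} [MeasurableSpace X] (k : ℕ) (c : NNReal) (ν : Measure X)
    [IsFiniteMeasure ν] :
    (Measure.pi fun _ : Fin k => c • ν) = (c ^ k) • Measure.pi fun _ : Fin k => ν := by
  refine Measure.pi_eq fun s hs => ?_
  simp only [Measure.smul_apply, Measure.pi_pi]
  simp [ENNReal.smul_def, Finset.prod_mul_distrib]

lemma pi_withDensity_unit {X : Type*} [MeasurableSpace X] (k : ℕ) (ν : Measure X)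
    [IsFiniteMeasure ν] {φ : X → ℝ} (hφ : Measurable φ) (h0 : ∀ x, 0 ≤ φ x) (h1 : ∀ x, φ x ≤ 1) :
    (Measure.pi fun _ : Fin k => ν.withDensity fun x => ENNReal.ofReal (φ x)) =
      (Measure.pi fun _ : Fin k => ν).withDensity
        fun p => ENNReal.ofReal (∏ i, φ (p i)) := by
  have := isFiniteMeasure_withDensity_unit (μ := ν) h1
  have hI : ∀ {Ω : Type _} [MeasurableSpace Ω] (m : Measure Ω) [IsFiniteMeasure m] {ψ : Ω → ℝ},
      Measurable ψ → (∀ x, 0 ≤ ψ x) → (∀ x, ψ x ≤ 1) → Integrable ψ m := fun m _ ψ hψ g0 g1 =>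
    Integrable.of_bound hψ.aestronglyMeasurable 1 (Filter.Eventually.of_forall fun x => by
      rw [Real.norm_of_nonneg (g0 x)]
      exact g1 x)
  refine Measure.pi_eq fun s hs => ?_
  have hprod : Measurable fun p : Fin k → X => ∏ i, φ (p i) :=
    Finset.measurable_prod _ fun i _ => hφ.comp (measurable_pi_apply i)
  rw [withDensity_apply _ (MeasurableSet.univ_pi hs), Measure.restrict_pi_pi,
    ← ofReal_integral_eq_lintegral_ofReal
      (hI _ hprod (fun p => Finset.prod_nonneg fun i _ => h0 _)
        fun p => Finset.prod_le_one (fun i _ => h0 _) fun i _ => h1 _)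
      (Filter.Eventually.of_forall fun p => Finset.prod_nonneg fun i _ => h0 _),
    integral_fintype_prod_eq_prod (fun _ : Fin k => φ),
    ENNReal.ofReal_prod_of_nonneg fun i _ => integral_nonneg h0]
  refine Finset.prod_congr rfl fun i _ => ?_
  rw [withDensity_apply _ (hs i), ← ofReal_integral_eq_lintegral_ofReal (hI _ hφ h0 h1)
    (Filter.Eventually.of_forall h0)]

/-- Weak convergence of finite measures implies weak convergence of their powers. If the limit is
not zero, the measures can be normalized; if it is zero, the masses tend to zero. -/
lemma tendsto_integral_pi {X : Type*} [TopologicalSpace X] [TopologicalSpace.MetrizableSpace X]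
    [SecondCountableTopology X] [Nonempty X] [MeasurableSpace X] [BorelSpace X] {l : Filter ℕ}
    {ν : ℕ → FiniteMeasure X} {β : FiniteMeasure X} (h : Filter.Tendsto ν l (𝓝 β)) {k : ℕ}
    (hk : 1 ≤ k) (F : BoundedContinuousFunction (Fin k → X) ℝ) :
    Filter.Tendsto (fun n => ∫ p, F p ∂(Measure.pi fun _ => (ν n : Measure X))) l
      (𝓝 (∫ p, F p ∂(Measure.pi fun _ => (β : Measure X)))) := by
  have hnorm : ∀ m : FiniteMeasure X, ∫ p, F p ∂(Measure.pi fun _ => (m : Measure X)) =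
      (m.mass : ℝ) ^ k * ∫ p, F p ∂(ProbabilityMeasure.pi fun _ : Fin k => m.normalize) :=
    fun m => by
      have h1 : (m : Measure X) = m.mass • (m.normalize : Measure X) := by
        conv_lhs => rw [m.self_eq_mass_smul_normalize]
        rfl
      rw [h1, pi_smul_const, integral_smul_nnreal_measure]
      simp [NNReal.smul_def]
  simp_rw [hnorm]
  have hmass : Filter.Tendsto (fun n => ((ν n).mass : ℝ) ^ k) l (𝓝 ((β.mass : ℝ) ^ k)) :=
    ((NNReal.continuous_coe.tendsto _).comp h.mass).pow k
  by_cases hβ : β = 0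
  · rw [hβ] at hmass ⊢
    have h0 : ((0 : FiniteMeasure X).mass : ℝ) ^ k = 0 := by
      simp [show k ≠ 0 by omega]
    rw [h0] at hmass ⊢
    rw [zero_mul]
    refine hmass.zero_mul_isBoundedUnder_le (Filter.isBoundedUnder_of ⟨‖F‖, fun n => ?_⟩)
    refine (norm_integral_le_of_norm_le_const
      (Filter.Eventually.of_forall F.norm_coe_le_norm)).trans ?_
    simp
  · refine hmass.mul ?_
    have h2 := FiniteMeasure.tendsto_normalize_of_tendsto h hβ
    have h3 := ((ProbabilityMeasure.continuous_pi (ι := Fin k) (α := fun _ => X)).tendsto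
      (fun _ => β.normalize)).comp (tendsto_pi_nhds.2 fun _ => h2)
    exact ProbabilityMeasure.tendsto_iff_forall_integral_tendsto.1 h3 F

/-- Vague convergence of measures implies convergence of the integrals of compactly supported
functions against their powers. -/
lemma VagueTendsto.tendsto_pi {d : ℕ} {U : Ultrafilter ℕ} {ν : ℕ → SubProb d} {β : SubProb d}
    (h : VagueTendsto U ν β) {k : ℕ} (hk : 1 ≤ k) (f : TestFn d k) (R : ℝ) :
    Filter.Tendsto (fun n => ∫ p : Fin k → E d × E d, (∏ i, bump R (p i)) * f.toFun (coords p)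
        ∂(Measure.pi fun _ => (ν n).1)) U
      (𝓝 (∫ p : Fin k → E d × E d, (∏ i, bump R (p i)) * f.toFun (coords p)
        ∂(Measure.pi fun _ => β.1))) := by
  have : Nonempty (Fin k) := ⟨⟨0, hk⟩⟩
  have hm : Measurable (bump (d := d) R) := (continuous_bump R).measurable
  let cut : SubProb d → FiniteMeasure (E d × E d) := fun α =>
    ⟨α.1.withDensity fun p => ENNReal.ofReal (bump R p),
      isFiniteMeasure_withDensity_unit (bump_le_one R)⟩
  have hcut : Filter.Tendsto (fun n => cut (ν n)) U (𝓝 (cut β)) := by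
    rw [FiniteMeasure.tendsto_iff_forall_integral_tendsto]
    intro φ
    have hc : ∀ α : SubProb d, ∫ p, φ p ∂(cut α : Measure (E d × E d)) =
        ∫ p, bump R p * φ p ∂α.1 := fun α => integral_withDensity_ofReal hm (bump_nonneg R) φ
    simp_rw [hc]
    exact h _ ((continuous_bump R).mul φ.continuous) (hasCompactSupport_bump R).mul_right
  let F : BoundedContinuousFunction (Fin k → E d × E d) ℝ :=
    BoundedContinuousFunction.ofNormedAddCommGroup (fun p => f.toFun (coords p))
      (f.continuous'.comp continuous_coords) f.supNorm fun p => f.abs_le_supNorm _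
  have hF : ∀ α : SubProb d, ∫ p, F p ∂(Measure.pi fun _ => (cut α : Measure (E d × E d))) =
      ∫ p : Fin k → E d × E d, (∏ i, bump R (p i)) * f.toFun (coords p)
        ∂(Measure.pi fun _ => α.1) := fun α => by
    have hc : (cut α : Measure (E d × E d)) =
      α.1.withDensity fun p => ENNReal.ofReal (bump R p) := rfl
    rw [hc, pi_withDensity_unit k α.1 hm (bump_nonneg R) (bump_le_one R),
      integral_withDensity_ofReal (W := fun p : Fin k → E d × E d => ∏ i, bump R (p i))
        (Finset.measurable_prod _ fun i _ => hm.comp (measurable_pi_apply i))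
        fun p => Finset.prod_nonneg fun i _ => bump_nonneg R _]
    rfl
  simp_rw [← hF]
  exact tendsto_integral_pi hcut hk F

end Powers


/-! ### Partitions of unity that are almost separated -/

section Combinatorics

lemma one_sub_prod_le_sum {ι : Type*} (s : Finset ι) (a : ι → ℝ) (h0 : ∀ i, 0 ≤ a i)
    (h1 : ∀ i, a i ≤ 1) : 1 - ∏ i ∈ s, a i ≤ ∑ i ∈ s, (1 - a i) := by
  classical
  induction s using Finset.induction_on with
  | empty => simp
  | insert i s hi ih =>
    rw [Finset.prod_insert hi, Finset.sum_insert hi]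
    have hp : ∏ j ∈ s, a j ≤ 1 := Finset.prod_le_one (fun j _ => h0 j) fun j _ => h1 j
    nlinarith [mul_nonneg (sub_nonneg.2 (h1 i)) (sub_nonneg.2 hp)]

/-- If the weights `w c j`, `w c' j'` never meet for `c ≠ c'`, then what the products over `j` miss
is bounded by what the weights themselves miss. -/
lemma abs_one_sub_sum_prod_le {Q : Type*} (s : Finset Q) {m : ℕ} (w : Q → Fin (m + 1) → ℝ)
    (h0 : ∀ c j, 0 ≤ w c j) (h1 : ∀ c j, w c j ≤ 1)
    (hsep : ∀ c ∈ s, ∀ c' ∈ s, ∀ j j', w c j ≠ 0 → w c' j' ≠ 0 → c = c') :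
    |1 - ∑ c ∈ s, ∏ j, w c j| ≤ ∑ j, (1 - ∑ c ∈ s, w c j) := by
  by_cases hex : ∃ c ∈ s, ∃ j, w c j ≠ 0
  · obtain ⟨c, hc, j, hj⟩ := hex
    have hz : ∀ c' ∈ s, c' ≠ c → ∀ j', w c' j' = 0 := fun c' hc' hne j' => by
      by_contra h
      exact hne (hsep c' hc' c hc j' j h hj)
    have hp : ∑ c ∈ s, ∏ j, w c j = ∏ j, w c j :=
      Finset.sum_eq_single_of_mem c hc fun c' hc' hne =>
        Finset.prod_eq_zero (Finset.mem_univ 0) (hz c' hc' hne 0)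
    have hs : ∀ j, ∑ c ∈ s, w c j = w c j := fun j =>
      Finset.sum_eq_single_of_mem c hc fun c' hc' hne => hz c' hc' hne j
    simp_rw [hp, hs]
    rw [abs_of_nonneg
      (sub_nonneg.2 (Finset.prod_le_one (fun j _ => h0 c j) fun j _ => h1 c j))]
    exact one_sub_prod_le_sum _ _ (h0 c) (h1 c)
  · push Not at hex
    have hp : ∑ c ∈ s, ∏ j, w c j = 0 := Finset.sum_eq_zero fun c hc =>
      Finset.prod_eq_zero (Finset.mem_univ 0) (hex c hc 0)
    have hs : ∀ j, ∑ c ∈ s, w c j = 0 := fun j => Finset.sum_eq_zero fun c hc => hex c hc j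
    simp_rw [hp, hs]
    simp

lemma sum_le_one_of_separated {Q : Type*} (s : Finset Q) (w : Q → ℝ) (h0 : ∀ c, 0 ≤ w c)
    (h1 : ∀ c, w c ≤ 1) (hsep : ∀ c ∈ s, ∀ c' ∈ s, w c ≠ 0 → w c' ≠ 0 → c = c') :
    ∑ c ∈ s, w c ≤ 1 := by
  have := (abs_nonneg _).trans (abs_one_sub_sum_prod_le s (m := 0) (fun c _ => w c)
    (fun c _ => h0 c) (fun c _ => h1 c) fun c hc c' hc' _ _ => hsep c hc c' hc')
  simpa using this

end Combinatorics

/-! ### Profiles of a sequence of measures -/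

section Profiles

variable {d : ℕ} (U : Ultrafilter ℕ) (μ : ℕ → SubProb d)

/-- Two sequences of centers are equivalent if their distance stays bounded. -/
def nearSetoid (d : ℕ) (U : Ultrafilter ℕ) : Setoid (ℕ → E d) where
  r x y := ∃ C : ℝ, ∀ᶠ n in (U : Filter ℕ), ‖x n - y n‖ ≤ C
  iseqv := by
    refine ⟨fun x => ⟨0, by simp⟩, ?_, ?_⟩
    · rintro x y ⟨C, hC⟩
      refine ⟨C, hC.mono fun n hn => ?_⟩
      rwa [norm_sub_rev]
    · rintro x y z ⟨C, hC⟩ ⟨C', hC'⟩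
      refine ⟨C + C', ?_⟩
      filter_upwards [hC, hC'] with n hn hn'
      calc ‖x n - z n‖ = ‖(x n - y n) + (y n - z n)‖ := by rw [sub_add_sub_cancel]
        _ ≤ C + C' := (norm_add_le _ _).trans (add_le_add hn hn')

/-- The classes of sequences of centers. -/
abbrev CenterClass (d : ℕ) (U : Ultrafilter ℕ) : Type := Quotient (nearSetoid d U)

/-- A sequence of centers in the given class. -/
def center {U : Ultrafilter ℕ} (c : CenterClass d U) : ℕ → E d := Quotient.out c

/-- The vague limit of the measures `μ n` seen from the centers of the class `c`. The centers are
those of a fixed representative of `c`; another one would translate the limit. -/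
def profile (c : CenterClass d U) : SubProb d :=
  (exists_vagueTendsto U fun n => (μ n).translate (-(center c n))).choose

lemma vagueTendsto_profile (c : CenterClass d U) :
    VagueTendsto U (fun n => (μ n).translate (-(center c n))) (profile U μ c) :=
  (exists_vagueTendsto U fun n => (μ n).translate (-(center c n))).choose_spec

variable {U}

lemma eventually_far {c c' : CenterClass d U} (h : c ≠ c') (D : ℝ) :
    ∀ᶠ n in (U : Filter ℕ), D < ‖center c n - center c' n‖ := by
  have hn : ¬ (nearSetoid d U).r (center c) (center c') := fun hr => h (by
    rw [← Quotient.out_eq c, ← Quotient.out_eq c']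
    exact Quotient.sound hr)
  have h1 : ¬ ∀ᶠ n in (U : Filter ℕ), ‖center c n - center c' n‖ ≤ D := fun h2 => hn ⟨D, h2⟩
  exact (Ultrafilter.eventually_not.2 h1).mono fun n => not_le.1

lemma eventually_far_finset (s : Finset (CenterClass d U)) (D : ℝ) :
    ∀ᶠ n in (U : Filter ℕ), ∀ c ∈ s, ∀ c' ∈ s, c ≠ c' → D < ‖center c n - center c' n‖ := by
  rw [Filter.eventually_all_finset]
  intro c _
  rw [Filter.eventually_all_finset]
  intro c' _
  by_cases h : c = c'
  · exact Filter.Eventually.of_forall fun n hne => absurd h hne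
  · exact (eventually_far h D).mono fun n hn _ => hn

/-- The plateau function of radius `R` centered at `(x, x)`. -/
def bumpAt (R : ℝ) (x : E d) (p : E d × E d) : ℝ := bump R (shift (-x) p)

lemma continuous_bumpAt (R : ℝ) (x : E d) : Continuous (bumpAt R x) :=
  (continuous_bump R).comp (continuous_shift _)

lemma bumpAt_nonneg (R : ℝ) (x : E d) (p : E d × E d) : 0 ≤ bumpAt R x p := bump_nonneg _ _

lemma norm_sub_lt_of_bumpAt_ne_zero {R : ℝ} {x : E d} {p : E d × E d} (h : bumpAt R x p ≠ 0) :
    ‖p.1 - x‖ < R + 1 ∧ ‖p.2 - x‖ < R + 1 := by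
  have h1 := norm_lt_of_bump_ne_zero h
  rw [Prod.norm_def, max_lt_iff] at h1
  simpa [shift, sub_eq_add_neg] using h1

lemma sum_bumpAt_le_one {s : Finset (CenterClass d U)} {R : ℝ} {n : ℕ}
    (h : ∀ c ∈ s, ∀ c' ∈ s, c ≠ c' → 2 * (R + 1) < ‖center c n - center c' n‖)
    (p : E d × E d) : ∑ c ∈ s, bumpAt R (center c n) p ≤ 1 := by
  refine sum_le_one_of_separated s _ (fun c => bump_nonneg _ _) (fun c => bump_le_one _ _)
    fun c hc c' hc' h1 h2 => ?_
  by_contra hne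
  have h3 := (norm_sub_lt_of_bumpAt_ne_zero h1).1
  have h4 := (norm_sub_lt_of_bumpAt_ne_zero h2).1
  have h5 := h c hc c' hc' hne
  have h6 : ‖center c n - center c' n‖ ≤ ‖p.1 - center c n‖ + ‖p.1 - center c' n‖ := by
    rw [norm_sub_rev p.1 (center c n)]
    calc ‖center c n - center c' n‖ = ‖(center c n - p.1) + (p.1 - center c' n)‖ := by
          rw [sub_add_sub_cancel]
      _ ≤ _ := norm_add_le _ _
  linarith

lemma integrable_bump (R : ℝ) (α : SubProb d) : Integrable (bump R) α.1 :=
  integrable_of_mem_unit (continuous_bump R) (bump_nonneg R) (bump_le_one R)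

lemma tendsto_bump (p : E d × E d) :
    Filter.Tendsto (fun R : ℕ => bump (R : ℝ) p) Filter.atTop (𝓝 1) := by
  obtain ⟨N, hN⟩ := exists_nat_ge ‖p‖
  refine tendsto_const_nhds.congr' ?_
  filter_upwards [Filter.eventually_ge_atTop N] with R hR
  exact (bump_eq_one (hN.trans (Nat.cast_le.2 hR))).symm

lemma tendsto_integral_bump (α : SubProb d) :
    Filter.Tendsto (fun R : ℕ => ∫ p, bump (R : ℝ) p ∂α.1) Filter.atTop
      (𝓝 (α.1.real Set.univ)) := by
  have h : ∫ _, (1 : ℝ) ∂α.1 = α.1.real Set.univ := by simp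
  rw [← h]
  refine tendsto_integral_of_dominated_convergence (fun _ => 1)
    (fun R => (continuous_bump R).measurable.aestronglyMeasurable) (integrable_const _)
    (fun R => Filter.Eventually.of_forall fun p => ?_)
    (Filter.Eventually.of_forall tendsto_bump)
  rw [Real.norm_of_nonneg (bump_nonneg _ _)]
  exact bump_le_one _ _

lemma tendsto_integral_profile (c : CenterClass d U) {g : E d × E d → ℝ} (hg : Continuous g)
    (hgc : HasCompactSupport g) :
    Filter.Tendsto (fun n => ∫ p, g (shift (-(center c n)) p) ∂(μ n).1) U
      (𝓝 (∫ p, g p ∂(profile U μ c).1)) := by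
  have h := vagueTendsto_profile U μ c g hg hgc
  simp_rw [integral_translate hg] at h
  exact h

/-- The profiles sit at mutually divergent centers, so that their masses add up to at most `1`. -/
lemma tsum_mass_profile_le : ∑' c : CenterClass d U, (orbitOf (profile U μ c)).mass ≤ 1 := by
  rw [ENNReal.tsum_eq_iSup_sum]
  refine iSup_le fun s => ?_
  have hR : ∀ R : ℕ, ∑ c ∈ s, ∫ p, bump (R : ℝ) p ∂(profile U μ c).1 ≤ 1 := fun R => by
    refine le_of_tendsto (tendsto_finsetSum s fun c _ =>
      tendsto_integral_profile μ c (continuous_bump (R : ℝ)) (hasCompactSupport_bump _)) ?_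
    filter_upwards [eventually_far_finset s (2 * ((R : ℝ) + 1))] with n hn
    have hi : ∀ c ∈ s, Integrable (fun p => bump (R : ℝ) (shift (-(center c n)) p)) (μ n).1 :=
      fun c _ => integrable_of_mem_unit (continuous_bumpAt _ _) (fun p => bump_nonneg _ _)
        fun p => bump_le_one _ _
    rw [← integral_finsetSum s hi]
    calc _ ≤ ∫ _, (1 : ℝ) ∂(μ n).1 := integral_mono (integrable_finsetSum s hi)
          (integrable_const _) fun p => sum_bumpAt_le_one hn p
      _ ≤ 1 := by simpa using (μ n).real_univ_le_one
  have hlim := le_of_tendsto'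
    (tendsto_finsetSum s fun c _ => tendsto_integral_bump (profile U μ c)) hR
  have hmass : ∀ c, (orbitOf (profile U μ c)).mass =
      ENNReal.ofReal ((profile U μ c).1.real Set.univ) := fun c => by
    rw [mass_orbitOf, ofReal_measureReal]
  simp_rw [hmass]
  rw [← ENNReal.ofReal_sum_of_nonneg fun c _ => measureReal_nonneg]
  exact ENNReal.ofReal_le_one.2 hlim

/-- The collection of the orbits of all profiles. -/
def profileCollection (U : Ultrafilter ℕ) (μ : ℕ → SubProb d) : Collection d :=
  ofFamily (fun c : CenterClass d U => orbitOf (profile U μ c)) (tsum_mass_profile_le μ)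

/-- Away from the large profiles, the measures `μ n` do not charge balls of a given radius: the
centers of balls with a larger mass would define a further profile. -/
lemma eventually_remainder_le {s : Finset (CenterClass d U)} {ε R : ℝ} (hε : 0 < ε)
    (hs : ∀ c ∉ s, (profile U μ c).1.real Set.univ ≤ ε)
    (hR : ∀ c ∈ s, ∫ p, (1 - bump R p) ∂(profile U μ c).1 ≤ ε) (r : ℝ) :
    ∀ᶠ n in (U : Filter ℕ), ∀ y : E d,
      ∫ p, bumpAt r y p * (1 - ∑ c ∈ s, bumpAt R (center c n) p) ∂(μ n).1 ≤ 2 * ε := by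
  classical
  by_contra hcon
  have h1 : ∀ᶠ n in (U : Filter ℕ), ∃ y : E d,
      2 * ε < ∫ p, bumpAt r y p * (1 - ∑ c ∈ s, bumpAt R (center c n) p) ∂(μ n).1 := by
    refine (Ultrafilter.eventually_not.2 hcon).mono fun n hn => ?_
    push Not at hn
    exact hn
  obtain ⟨y, hy⟩ := h1.choice
  let c : CenterClass d U := Quotient.mk (nearSetoid d U) y
  obtain ⟨C, hC⟩ : (nearSetoid d U).r y (center c) :=
    (nearSetoid d U).symm (Quotient.exact (s := nearSetoid d U) (Quotient.out_eq c))
  -- a lower bound, in the coordinates centered at `c`, for the part that the family `s` covers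
  obtain ⟨φ, hφ, hφ0, hφ1, hφs, hφε⟩ : ∃ φ : E d × E d → ℝ, Continuous φ ∧ (∀ p, 0 ≤ φ p) ∧
      (∀ p, φ p ≤ 1) ∧ (∀ n p, φ (shift (-(center c n)) p) ≤
        ∑ c ∈ s, bumpAt R (center c n) p) ∧ ∫ p, (1 - φ p) ∂(profile U μ c).1 ≤ ε := by
    by_cases hc : c ∈ s
    · exact ⟨bump R, continuous_bump R, bump_nonneg R, bump_le_one R, fun n p =>
        Finset.single_le_sum (f := fun c => bumpAt R (center c n) p)
          (fun c _ => bump_nonneg _ _) hc, hR c hc⟩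
    · refine ⟨fun _ => 0, continuous_const, fun _ => le_rfl, fun _ => zero_le_one,
        fun n p => Finset.sum_nonneg fun c _ => bump_nonneg _ _, ?_⟩
      simpa using hs c hc
  set G : E d × E d → ℝ := bump (r + 1 + C) with hG
  have hGφ : Continuous fun p => G p * (1 - φ p) :=
    (continuous_bump _).mul (continuous_const.sub hφ)
  have hGc : HasCompactSupport fun p => G p * (1 - φ p) :=
    (hasCompactSupport_bump (r + 1 + C)).mul_right
  have h2 : 2 * ε ≤ ∫ p, G p * (1 - φ p) ∂(profile U μ c).1 := by
    refine ge_of_tendsto (tendsto_integral_profile μ c hGφ hGc) ?_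
    filter_upwards [hy, hC, eventually_far_finset s (2 * (R + 1))] with n hn hCn hfar
    refine hn.le.trans (integral_mono ?_ ?_ fun p => ?_)
    · refine integrable_of_mem_unit ((continuous_bumpAt _ _).mul (continuous_const.sub
        (continuous_finsetSum _ fun c _ => continuous_bumpAt _ _))) (fun p => ?_) fun p => ?_
      · exact mul_nonneg (bump_nonneg _ _) (sub_nonneg.2 (sum_bumpAt_le_one hfar p))
      · exact mul_le_one₀ (bump_le_one _ _) (sub_nonneg.2 (sum_bumpAt_le_one hfar p))
          (sub_le_self _ (Finset.sum_nonneg fun c _ => bump_nonneg _ _))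
    · exact integrable_of_mem_unit (hGφ.comp (continuous_shift _))
        (fun p => mul_nonneg (bump_nonneg _ _) (sub_nonneg.2 (hφ1 _)))
        fun p => mul_le_one₀ (bump_le_one _ _) (sub_nonneg.2 (hφ1 _)) (sub_le_self _ (hφ0 _))
    · refine mul_le_mul ?_ (sub_le_sub_left (hφs n p) 1)
        (sub_nonneg.2 (sum_bumpAt_le_one hfar p)) (bump_nonneg _ _)
      by_cases hp : bumpAt r (y n) p = 0
      · rw [hp]
        exact bump_nonneg _ _
      · obtain ⟨hp1, hp2⟩ := norm_sub_lt_of_bumpAt_ne_zero hp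
        have hle : ∀ v : E d, ‖v - y n‖ < r + 1 → ‖v + -center c n‖ ≤ r + 1 + C := fun v hv => by
          calc ‖v + -center c n‖ = ‖(v - y n) + (y n - center c n)‖ := by
                rw [sub_add_sub_cancel, sub_eq_add_neg]
            _ ≤ r + 1 + C := (norm_add_le _ _).trans (add_le_add hv.le hCn)
        have hone : G (shift (-(center c n)) p) = 1 :=
          bump_eq_one (max_le (hle _ hp1) (hle _ hp2))
        rw [hone]
        exact bump_le_one _ _
  have h3 : ∫ p, G p * (1 - φ p) ∂(profile U μ c).1 ≤ ∫ p, (1 - φ p) ∂(profile U μ c).1 := by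
    refine integral_mono ?_ ?_ fun p => ?_
    · exact integrable_of_mem_unit hGφ
        (fun p => mul_nonneg (bump_nonneg _ _) (sub_nonneg.2 (hφ1 _)))
        fun p => mul_le_one₀ (bump_le_one _ _) (sub_nonneg.2 (hφ1 _)) (sub_le_self _ (hφ0 _))
    · exact integrable_of_mem_unit (continuous_const.sub hφ) (fun p => sub_nonneg.2 (hφ1 _))
        fun p => sub_le_self _ (hφ0 _)
    · exact mul_le_of_le_one_left (sub_nonneg.2 (hφ1 _)) (bump_le_one _ _)
  linarith

end Profiles


/-! ### The functionals converge to those of the profiles -/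

section Limit

variable {d : ℕ}

/-- A bound on the partial integrals of a function of two points bounds its integral against a
power of a sub-probability measure: the variable `p b` is integrated first. -/
lemma integral_pi_pair_le {X : Type*} [MeasurableSpace X] (ν : Measure X) [IsFiniteMeasure ν]
    (hν : ν.real Set.univ ≤ 1) {m : ℕ} (b : Fin (m + 1)) (a : Fin m) (H : X → X → ℝ)
    (hH : Measurable fun z : X × X => H z.1 z.2) (h0 : ∀ x y, 0 ≤ H x y) (h1 : ∀ x y, H x y ≤ 1)
    {δ : ℝ} (hδ0 : 0 ≤ δ) (hδ : ∀ x, ∫ y, H x y ∂ν ≤ δ) :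
    ∫ p : Fin (m + 1) → X, H (p (b.succAbove a)) (p b) ∂(Measure.pi fun _ => ν) ≤ δ := by
  have hmp := (measurePreserving_piFinSuccAbove (fun _ : Fin (m + 1) => ν) b).symm
  have hint : Integrable (fun z : X × (Fin m → X) => H (z.2 a) z.1)
      (ν.prod (Measure.pi fun _ => ν)) :=
    Integrable.of_bound (hH.comp (by fun_prop :
      Measurable fun z : X × (Fin m → X) => (z.2 a, z.1))).aestronglyMeasurable 1
      (Filter.Eventually.of_forall fun z => by
        rw [Real.norm_of_nonneg (h0 _ _)]
        exact h1 _ _)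
  rw [← hmp.integral_comp' (g := fun p : Fin (m + 1) → X => H (p (b.succAbove a)) (p b))]
  have hfun : ∀ z : X × (Fin m → X),
      H ((MeasurableEquiv.piFinSuccAbove (fun _ => X) b).symm z (b.succAbove a))
        ((MeasurableEquiv.piFinSuccAbove (fun _ => X) b).symm z b) = H (z.2 a) z.1 := fun z => by
    simp [MeasurableEquiv.piFinSuccAbove, Fin.insertNthEquiv]
  simp_rw [hfun]
  rw [integral_prod_symm _ hint]
  have hpi1 : (Measure.pi fun _ : Fin m => ν).real Set.univ ≤ 1 := by
    rw [Measure.real, Measure.pi_univ, ENNReal.toReal_prod]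
    exact Finset.prod_le_one (fun _ _ => ENNReal.toReal_nonneg) fun _ _ => hν
  calc ∫ q : Fin m → X, ∫ x, H (q a) x ∂ν ∂(Measure.pi fun _ => ν)
      ≤ ∫ _ : Fin m → X, δ ∂(Measure.pi fun _ => ν) :=
        integral_mono hint.integral_prod_right (integrable_const _) fun q => hδ (q a)
    _ ≤ δ := by
        rw [integral_const, smul_eq_mul]
        exact mul_le_of_le_one_left hδ0 hpi1

variable (U : Ultrafilter ℕ) (μ : ℕ → SubProb d)

lemma integral_pi_translate {k : ℕ} (f : TestFn d k) (R : ℝ) (x : E d) (α : SubProb d) :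
    ∫ p : Fin k → E d × E d, (∏ i, bump R (p i)) * f.toFun (coords p)
        ∂(Measure.pi fun _ => (α.translate (-x)).1) =
      ∫ p : Fin k → E d × E d, (∏ i, bumpAt R x (p i)) * f.toFun (coords p)
        ∂(Measure.pi fun _ => α.1) := by
  have hpi : (Measure.pi fun _ : Fin k => (α.translate (-x)).1) =
      (Measure.pi fun _ : Fin k => α.1).map (fun p i => shift (-x) (p i)) := by
    have : IsFiniteMeasure (α.1.map (shift (-x))) := isFiniteMeasure_subProb (α.translate (-x))
    exact (Measure.pi_map_pi (μ := fun _ : Fin k => α.1) (f := fun _ => shift (-x))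
      (fun _ => (measurable_shift (-x)).aemeasurable)).symm
  rw [hpi, integral_map]
  · refine integral_congr_ae (Filter.Eventually.of_forall fun p => ?_)
    have hs : coords (fun i => shift (-x) (p i)) = fun i => coords p i + -x := by
      funext i
      rcases i with i | i <;> rfl
    simp only [hs, f.invariant' (-x)]
    rfl
  · exact (measurable_pi_lambda _ fun i =>
      (measurable_shift (-x)).comp (measurable_pi_apply i)).aemeasurable
  · exact ((continuous_finsetProd _ fun i _ => (continuous_bump R).comp (continuous_apply i)).mul
      (f.continuous'.comp continuous_coords)).measurable.aestronglyMeasurable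

/-- On the support of a test function of bounded range, the configurations that are not covered
by a single profile contain a point in the remainder, close to another point. -/
lemma abs_mul_one_sub_le {m : ℕ} (f : TestFn d (m + 2)) {r : ℝ} (hr : 0 ≤ r)
    (hf : ∀ x, (∃ i j, i ≠ j ∧ r < dist (x i) (x j)) → f.toFun x = 0)
    {s : Finset (CenterClass d U)} {R : ℝ} {n : ℕ}
    (hfar : ∀ c ∈ s, ∀ c' ∈ s, c ≠ c' → 2 * (R + 1) + r < ‖center c n - center c' n‖)
    (p : Fin (m + 2) → E d × E d) :
    |(1 - ∑ c ∈ s, ∏ i, bumpAt R (center c n) (p i)) * f.toFun (coords p)| ≤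
      f.supNorm * ∑ i : Fin (m + 2), bumpAt r (p (i.succAbove 0)).1 (p i) *
        (1 - ∑ c ∈ s, bumpAt R (center c n) (p i)) := by
  have hfar' : ∀ c ∈ s, ∀ c' ∈ s, c ≠ c' → 2 * (R + 1) < ‖center c n - center c' n‖ :=
    fun c hc c' hc' hne => lt_of_le_of_lt (by linarith) (hfar c hc c' hc' hne)
  by_cases h0 : f.toFun (coords p) = 0
  · rw [h0, mul_zero, abs_zero]
    exact mul_nonneg f.supNorm_nonneg (Finset.sum_nonneg fun i _ =>
      mul_nonneg (bump_nonneg _ _) (sub_nonneg.2 (sum_bumpAt_le_one hfar' _)))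
  have hclose : ∀ a b, dist (coords p a) (coords p b) ≤ r := fun a b => by
    by_cases hab : a = b
    · rw [hab, dist_self]
      exact hr
    · by_contra hcon
      exact h0 (hf _ ⟨a, b, hab, not_le.1 hcon⟩)
  have hone : ∀ i : Fin (m + 2), bumpAt r (p (i.succAbove 0)).1 (p i) = 1 := fun i => by
    refine bump_eq_one (max_le ?_ ?_)
    · have := hclose (Sum.inl i) (Sum.inl (i.succAbove 0))
      rw [dist_eq_norm, sub_eq_add_neg] at this
      exact this
    · have := hclose (Sum.inr i) (Sum.inl (i.succAbove 0))
      rw [dist_eq_norm, sub_eq_add_neg] at this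
      exact this
  simp_rw [hone, one_mul]
  rw [abs_mul, mul_comm]
  refine mul_le_mul (f.abs_le_supNorm _) ?_ (abs_nonneg _) f.supNorm_nonneg
  refine abs_one_sub_sum_prod_le s _ (fun c j => bump_nonneg _ _) (fun c j => bump_le_one _ _)
    fun c hc c' hc' j j' h1 h2 => ?_
  by_contra hne
  have h3 := (norm_sub_lt_of_bumpAt_ne_zero h1).1
  have h4 := (norm_sub_lt_of_bumpAt_ne_zero h2).1
  have h5 := hfar c hc c' hc' hne
  have h6 := hclose (Sum.inl j) (Sum.inl j')
  change dist (p j).1 (p j').1 ≤ r at h6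
  rw [← dist_eq_norm] at h3 h4 h5
  have h7 : dist (center c n) (center c' n) ≤
      dist (center c n) (p j).1 + dist (p j).1 (p j').1 + dist (p j').1 (center c' n) :=
    dist_triangle4 _ _ _ _
  rw [dist_comm (center c n) (p j).1] at h7
  linarith

/-- The error made by keeping only finitely many profiles, cut off at a finite radius. -/
lemma eventually_abs_Lam_sub_le {m : ℕ} (f : TestFn d (m + 2)) {r : ℝ} (hr : 0 ≤ r)
    (hf : ∀ x, (∃ i j, i ≠ j ∧ r < dist (x i) (x j)) → f.toFun x = 0)
    {s : Finset (CenterClass d U)} {ε R : ℝ} (hε : 0 < ε)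
    (hs : ∀ c ∉ s, (profile U μ c).1.real Set.univ ≤ ε)
    (hR : ∀ c ∈ s, ∫ p, (1 - bump R p) ∂(profile U μ c).1 ≤ ε) :
    ∀ᶠ n in (U : Filter ℕ), |Lam f (μ n) - ∑ c ∈ s, ∫ p : Fin (m + 2) → E d × E d,
      (∏ i, bump R (p i)) * f.toFun (coords p)
        ∂(Measure.pi fun _ => ((μ n).translate (-(center c n))).1)| ≤
      f.supNorm * ((m + 2 : ℕ) * (2 * ε)) := by
  filter_upwards [eventually_remainder_le μ hε hs hR r,
    eventually_far_finset s (2 * (R + 1) + r)] with n hn hfar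
  have hfar' : ∀ c ∈ s, ∀ c' ∈ s, c ≠ c' → 2 * (R + 1) < ‖center c n - center c' n‖ :=
    fun c hc c' hc' hne => lt_of_le_of_lt (by linarith) (hfar c hc c' hc' hne)
  simp_rw [integral_pi_translate]
  have hfint := integrable_testFn (by omega) f (Measure.pi fun _ : Fin (m + 2) => (μ n).1)
  have hcint : ∀ c ∈ s, Integrable (fun p : Fin (m + 2) → E d × E d =>
      (∏ i, bumpAt R (center c n) (p i)) * f.toFun (coords p))
        (Measure.pi fun _ => (μ n).1) := fun c _ => by
    refine hfint.bdd_mul (c := 1) ?_ (Filter.Eventually.of_forall fun p => ?_)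
    · exact (continuous_finsetProd _ fun i _ =>
        (continuous_bumpAt _ _).comp (continuous_apply i)).aestronglyMeasurable
    · rw [Real.norm_of_nonneg (Finset.prod_nonneg fun i _ =>
        bumpAt_nonneg R (center c n) (p i))]
      exact Finset.prod_le_one (fun i _ => bump_nonneg _ _) fun i _ => bump_le_one _ _
  have hH : ∀ i : Fin (m + 2), ∫ p : Fin (m + 2) → E d × E d,
      bumpAt r (p (i.succAbove 0)).1 (p i) * (1 - ∑ c ∈ s, bumpAt R (center c n) (p i))
        ∂(Measure.pi fun _ => (μ n).1) ≤ 2 * ε := fun i =>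
    integral_pi_pair_le (μ n).1 (μ n).real_univ_le_one i 0
      (fun q p => bumpAt r q.1 p * (1 - ∑ c ∈ s, bumpAt R (center c n) p))
      (by
        have h1 : Continuous fun z : (E d × E d) × (E d × E d) => bumpAt r z.1.1 z.2 :=
          (continuous_bump r).comp (by unfold shift; fun_prop)
        exact (h1.mul (continuous_const.sub (continuous_finsetSum _ fun c _ =>
          (continuous_bumpAt _ _).comp continuous_snd))).measurable)
      (fun q p => mul_nonneg (bump_nonneg _ _) (sub_nonneg.2 (sum_bumpAt_le_one hfar' p)))
      (fun q p => mul_le_one₀ (bump_le_one _ _) (sub_nonneg.2 (sum_bumpAt_le_one hfar' p))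
        (sub_le_self _ (Finset.sum_nonneg fun c _ => bump_nonneg _ _)))
      (by positivity) fun q => hn q.1
  have hHint : ∀ i ∈ (Finset.univ : Finset (Fin (m + 2))),
      Integrable (fun p : Fin (m + 2) → E d × E d => bumpAt r (p (i.succAbove 0)).1 (p i) *
        (1 - ∑ c ∈ s, bumpAt R (center c n) (p i))) (Measure.pi fun _ => (μ n).1) := fun i _ => by
    refine integrable_of_mem_unit ?_ (fun p => mul_nonneg (bump_nonneg _ _)
      (sub_nonneg.2 (sum_bumpAt_le_one hfar' _))) fun p => mul_le_one₀ (bump_le_one _ _)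
        (sub_nonneg.2 (sum_bumpAt_le_one hfar' _))
        (sub_le_self _ (Finset.sum_nonneg fun c _ => bump_nonneg _ _))
    refine Continuous.mul ((continuous_bump r).comp (by unfold shift; fun_prop)) ?_
    exact continuous_const.sub (continuous_finsetSum _ fun c _ =>
      (continuous_bumpAt _ _).comp (continuous_apply i))
  rw [← integral_finsetSum s hcint, Lam, ← integral_sub hfint (integrable_finsetSum s hcint)]
  calc |∫ p : Fin (m + 2) → E d × E d, (f.toFun (coords p) - ∑ c ∈ s,
          (∏ i, bumpAt R (center c n) (p i)) * f.toFun (coords p)) ∂(Measure.pi fun _ => (μ n).1)|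
      ≤ ∫ p : Fin (m + 2) → E d × E d, f.supNorm * ∑ i : Fin (m + 2),
          bumpAt r (p (i.succAbove 0)).1 (p i) * (1 - ∑ c ∈ s, bumpAt R (center c n) (p i))
            ∂(Measure.pi fun _ => (μ n).1) := by
        rw [← Real.norm_eq_abs]
        refine norm_integral_le_of_norm_le ((integrable_finsetSum _ hHint).const_mul _)
          (Filter.Eventually.of_forall fun p => ?_)
        have := abs_mul_one_sub_le U f hr hf hfar p
        rwa [sub_mul, one_mul, Finset.sum_mul] at this
    _ = f.supNorm * ∑ i : Fin (m + 2), ∫ p : Fin (m + 2) → E d × E d,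
          bumpAt r (p (i.succAbove 0)).1 (p i) * (1 - ∑ c ∈ s, bumpAt R (center c n) (p i))
            ∂(Measure.pi fun _ => (μ n).1) := by
        rw [integral_const_mul, integral_finsetSum _ hHint]
    _ ≤ f.supNorm * ((m + 2 : ℕ) * (2 * ε)) := by
        refine mul_le_mul_of_nonneg_left ?_ f.supNorm_nonneg
        refine (Finset.sum_le_sum fun i _ => hH i).trans (le_of_eq ?_)
        rw [Finset.sum_const, Finset.card_univ, Fintype.card_fin, nsmul_eq_mul]

lemma tendsto_integral_cutoff {k : ℕ} (hk : 1 ≤ k) (f : TestFn d k) (α : SubProb d) :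
    Filter.Tendsto (fun R : ℕ => ∫ p : Fin k → E d × E d,
      (∏ i, bump (R : ℝ) (p i)) * f.toFun (coords p) ∂(Measure.pi fun _ => α.1)) Filter.atTop
      (𝓝 (Lam f α)) := by
  have : Nonempty (Fin k) := ⟨⟨0, hk⟩⟩
  refine tendsto_integral_of_dominated_convergence (fun _ => f.supNorm) (fun R => ?_)
    (integrable_const _) (fun R => Filter.Eventually.of_forall fun p => ?_)
    (Filter.Eventually.of_forall fun p => ?_)
  · exact ((continuous_finsetProd _ fun i _ => (continuous_bump _).comp (continuous_apply i)).mul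
      (f.continuous'.comp continuous_coords)).measurable.aestronglyMeasurable
  · rw [norm_mul, Real.norm_of_nonneg (Finset.prod_nonneg fun i _ => bump_nonneg _ _)]
    exact (mul_le_of_le_one_left (norm_nonneg _) (Finset.prod_le_one
      (fun i _ => bump_nonneg _ _) fun i _ => bump_le_one _ _)).trans (f.abs_le_supNorm _)
  · have h := (tendsto_finsetProd (Finset.univ : Finset (Fin k))
      fun i _ => tendsto_bump (p i)).mul_const (f.toFun (coords p))
    simpa using h

lemma tendsto_Lam_of_bounded_range {m : ℕ} (f : TestFn d (m + 2)) {r : ℝ} (hr : 0 ≤ r)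
    (hf : ∀ x, (∃ i j, i ≠ j ∧ r < dist (x i) (x j)) → f.toFun x = 0) :
    Filter.Tendsto (fun n => Lam f (μ n)) U (𝓝 ((profileCollection U μ).sumLam f)) := by
  classical
  have hk : 1 ≤ m + 2 := by omega
  have hsum := summable_Lam hk _ (tsum_mass_profile_le (U := U) μ) f
  rw [profileCollection, sumLam_ofFamily hk]
  refine Metric.tendsto_nhds.2 fun η hη => ?_
  -- the three `ε` pay for the profiles outside `s`, the cutoff radius, and the vague convergence
  obtain ⟨ε, hε, hεη⟩ : ∃ ε : ℝ, 0 < ε ∧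
      f.supNorm * ((m + 2 : ℕ) * (2 * ε)) + (ε + ε + ε) < η := by
    have hK : 0 ≤ f.supNorm * (m + 2 : ℕ) := mul_nonneg f.supNorm_nonneg (Nat.cast_nonneg _)
    set K := f.supNorm * (m + 2 : ℕ) with hKdef
    refine ⟨η / (2 * (2 * K + 3)), by positivity, ?_⟩
    have h1 : (2 * K + 3) * (η / (2 * (2 * K + 3))) = η / 2 := by
      field_simp
    rw [← mul_assoc, ← hKdef]
    linarith
  obtain ⟨s, hs, hsε⟩ : ∃ s : Finset (CenterClass d U),
      (∀ c ∉ s, (profile U μ c).1.real Set.univ ≤ ε) ∧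
      |∑ c ∈ s, Lam f (profile U μ c) - ∑' c, (orbitOf (profile U μ c)).Lam f| < ε := by
    have hmass := (summable_realMass _ (tsum_mass_profile_le (U := U) μ)).tendsto_cofinite_zero
    have hfin : {c : CenterClass d U | ¬ (orbitOf (profile U μ c)).realMass < ε}.Finite :=
      Filter.mem_cofinite.1 ((hmass.eventually_lt_const hε))
    have h1 := (Metric.tendsto_nhds.1 hsum.hasSum ε hε).and
      (Filter.eventually_ge_atTop hfin.toFinset)
    obtain ⟨s, hs1, hs2⟩ := h1.exists
    refine ⟨s, fun c hc => ?_, hs1⟩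
    by_contra hcon
    refine hc (hs2 (hfin.mem_toFinset.2 fun hlt => hcon ?_))
    rw [realMass_orbitOf] at hlt
    exact hlt.le
  obtain ⟨R, hR, hRε⟩ : ∃ R : ℕ,
      (∀ c ∈ s, ∫ p, (1 - bump (R : ℝ) p) ∂(profile U μ c).1 ≤ ε) ∧
      |∑ c ∈ s, ∫ p : Fin (m + 2) → E d × E d, (∏ i, bump (R : ℝ) (p i)) * f.toFun (coords p)
        ∂(Measure.pi fun _ => (profile U μ c).1) - ∑ c ∈ s, Lam f (profile U μ c)| < ε := by
    have h1 : ∀ᶠ R : ℕ in Filter.atTop,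
        ∀ c ∈ s, ∫ p, (1 - bump (R : ℝ) p) ∂(profile U μ c).1 ≤ ε := by
      rw [Filter.eventually_all_finset]
      intro c _
      have h2 := (tendsto_integral_bump (profile U μ c)).const_sub
        ((profile U μ c).1.real Set.univ)
      rw [sub_self] at h2
      filter_upwards [h2.eventually_le_const hε] with R hR
      rw [integral_sub (integrable_const _) (integrable_bump _ _)]
      simpa using hR
    have h2 := tendsto_finsetSum s fun c _ => tendsto_integral_cutoff hk f (profile U μ c)
    exact (h1.and (Metric.tendsto_nhds.1 h2 ε hε)).exists
  have hconv := tendsto_finsetSum s fun c _ =>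
    (vagueTendsto_profile U μ c).tendsto_pi hk f (R : ℝ)
  filter_upwards [eventually_abs_Lam_sub_le U μ f hr hf hε hs hR,
    Metric.tendsto_nhds.1 hconv ε hε] with n h1 h2
  rw [Real.dist_eq] at h2 ⊢
  refine lt_of_le_of_lt ?_ hεη
  refine (abs_sub_le _ _ _).trans (add_le_add h1 ?_)
  refine (abs_sub_le _ _ _).trans (le_trans (add_le_add h2.le ((abs_sub_le _ _ _).trans
    (add_le_add hRε.le hsε.le))) (le_of_eq (add_assoc _ _ _).symm))

/-- The test function `f` with its values of modulus at most `ε` replaced by `0`, and with the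
other ones moved towards `0` by `ε`. -/
def softThreshold {k : ℕ} (f : TestFn d k) (ε : ℝ) (hε : 0 < ε) : TestFn d k where
  toFun x := f.toFun x - max (-ε) (min ε (f.toFun x))
  continuous' := f.continuous'.sub (continuous_const.max (continuous_const.min f.continuous'))
  invariant' a x := by rw [f.invariant']
  vanishing' δ hδ := by
    obtain ⟨R, hR⟩ := f.vanishing' ε hε
    refine ⟨R, fun x hx => ?_⟩
    obtain ⟨h1, h2⟩ := abs_lt.1 (hR x hx)
    rw [min_eq_right h2.le, max_eq_right h1.le, sub_self, abs_zero]
    exact hδ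

lemma softThreshold_range {k : ℕ} (f : TestFn d k) {ε : ℝ} (hε : 0 < ε) :
    ∃ r : ℝ, 0 ≤ r ∧ ∀ x, (∃ i j, i ≠ j ∧ r < dist (x i) (x j)) →
      (softThreshold f ε hε).toFun x = 0 := by
  obtain ⟨R, hR⟩ := f.vanishing' ε hε
  refine ⟨max R 0, le_max_right _ _, fun x ⟨i, j, hij, hx⟩ => ?_⟩
  obtain ⟨h1, h2⟩ := abs_lt.1 (hR x ⟨i, j, hij, (le_max_left _ _).trans_lt hx⟩)
  change f.toFun x - max (-ε) (min ε (f.toFun x)) = 0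
  rw [min_eq_right h2.le, max_eq_right h1.le, sub_self]

lemma abs_sub_softThreshold_le {k : ℕ} (f : TestFn d k) {ε : ℝ} (hε : 0 < ε)
    (x : Fin k ⊕ Fin k → E d) : |f.toFun x - (softThreshold f ε hε).toFun x| ≤ ε := by
  change |f.toFun x - (f.toFun x - max (-ε) (min ε (f.toFun x)))| ≤ ε
  rw [sub_sub_cancel, abs_le]
  exact ⟨le_max_left _ _, max_le (by linarith) (min_le_left _ _)⟩

/-- Along an ultrafilter, every sequence of single orbits converges to its collection of
profiles. -/
lemma tendsto_Lam_profileCollection {k : ℕ} (hk : 2 ≤ k) (f : TestFn d k) :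
    Filter.Tendsto (fun n => Lam f (μ n)) U (𝓝 ((profileCollection U μ).sumLam f)) := by
  obtain ⟨m, rfl⟩ := Nat.exists_eq_add_of_le' hk
  have hk1 : 1 ≤ m + 2 := by omega
  refine Metric.tendsto_nhds.2 fun η hη => ?_
  have hε : 0 < η / 3 := by positivity
  obtain ⟨r, hr, hg⟩ := softThreshold_range f hε
  have hle := abs_sub_softThreshold_le f hε
  filter_upwards [Metric.tendsto_nhds.1 (tendsto_Lam_of_bounded_range U μ _ hr hg) _ hε] with n hn
  have h1 := abs_Lam_sub_le hk1 f _ hε.le hle (μ n)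
  have h2 := (profileCollection U μ).abs_sumLam_sub_le hk1 f _ hε.le hle
  have h3 := mul_le_of_le_one_right hε.le (μ n).real_univ_le_one
  rw [abs_sub_comm] at h2
  rw [Real.dist_eq] at hn ⊢
  have h4 := abs_sub_le (Lam f (μ n)) (Lam (softThreshold f (η / 3) hε) (μ n))
    ((profileCollection U μ).sumLam f)
  have h5 := abs_sub_le (Lam (softThreshold f (η / 3) hε) (μ n))
    ((profileCollection U μ).sumLam (softThreshold f (η / 3) hε))
    ((profileCollection U μ).sumLam f)
  linarith

end Limit

/-! ### The metric space of collections -/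

section Metric

variable {d : ℕ} {f : ℕ → AllTestFn d}

/-- The metric space structure defined by `D2`. -/
abbrev metricSpaceD2 (hf : IsDenseSequence f) : MetricSpace (Collection d) where
  dist := D2 f
  dist_self := D2_self f
  dist_comm := D2_comm f
  dist_triangle := D2_triangle f
  eq_of_dist_eq_zero h := Collection.ext_of_sumLam fun _ hk g => sumLam_eq_of_D2_eq_zero hf h hk g

lemma exists_probOrbits_tendsto (hd : 0 < d) (ξ : Collection d) :
    ∃ μ : ℕ → SubProb d, (∀ n, single (μ n) ∈ probOrbits d) ∧
      Filter.Tendsto (fun n => D2 f (single (μ n)) ξ) Filter.atTop (𝓝 0) := by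
  obtain ⟨μ, hμ, hlim⟩ := ξ.exists_prob_tendsto hd
  refine ⟨μ, fun n => single_mem_probOrbits (hμ n), tendsto_D2_zero fun k hk g => ?_⟩
  simp_rw [sumLam_single (one_le_two.trans hk)]
  exact hlim k hk g

lemma dense_probOrbits (hd : 0 < d) (hf : IsDenseSequence f) :
    @Dense (Collection d) (metricSpaceD2 hf).toUniformSpace.toTopologicalSpace
      (probOrbits d) := by
  let := metricSpaceD2 hf
  intro ξ
  obtain ⟨μ, hμ, hlim⟩ := exists_probOrbits_tendsto (f := f) hd ξ
  exact mem_closure_of_tendsto (tendsto_iff_dist_tendsto_zero.2 hlim)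
    (Filter.Eventually.of_forall hμ)

lemma compactSpace_D2 (hd : 0 < d) (hf : IsDenseSequence f) :
    @CompactSpace (Collection d) (metricSpaceD2 hf).toUniformSpace.toTopologicalSpace := by
  let := metricSpaceD2 hf
  rw [compactSpace_iff_seqCompactSpace]
  refine ⟨fun ξ _ => ?_⟩
  -- by density, it suffices to treat sequences of single orbits
  have hex : ∀ n : ℕ, ∃ α : SubProb d, dist (ξ n) (single α) < 1 / (n + 1) := fun n => by
    obtain ⟨μ, -, hlim⟩ := exists_probOrbits_tendsto (f := f) hd (ξ n)
    obtain ⟨i, hi⟩ := (hlim.eventually_lt_const (show (0 : ℝ) < 1 / (n + 1) by positivity)).exists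
    refine ⟨μ i, ?_⟩
    rw [dist_comm]
    exact hi
  choose μ hμ using hex
  let U : Ultrafilter ℕ := Filter.hyperfilter ℕ
  have hU : (U : Filter ℕ) ≤ Filter.atTop := by
    rw [← Nat.cofinite_eq_atTop]
    exact Filter.hyperfilter_le_cofinite
  have h1 : Filter.Tendsto (fun n => dist (single (μ n)) (profileCollection U μ)) U (𝓝 0) := by
    refine tendsto_D2_zero (f := f) fun k hk g => ?_
    simp_rw [sumLam_single (one_le_two.trans hk)]
    exact tendsto_Lam_profileCollection U μ hk g
  have h2 : Filter.Tendsto (fun n => dist (ξ n) (single (μ n))) U (𝓝 0) :=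
    squeeze_zero (fun n => dist_nonneg) (fun n => (hμ n).le)
      (tendsto_one_div_add_atTop_nhds_zero_nat.mono_left hU)
  have h3 : Filter.Tendsto ξ U (𝓝 (profileCollection U μ)) := by
    rw [tendsto_iff_dist_tendsto_zero]
    refine squeeze_zero (fun n => dist_nonneg) (fun n => dist_triangle _ (single (μ n)) _) ?_
    simpa using h2.add h1
  have h4 : MapClusterPt (profileCollection U μ) Filter.atTop ξ := by
    refine Filter.NeBot.mono (f := 𝓝 (profileCollection U μ) ⊓ Filter.map ξ U) ?_
      (inf_le_inf_left _ (Filter.map_mono hU))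
    rw [inf_eq_right.2 h3]
    infer_instance
  obtain ⟨φ, hφ, hlim⟩ := h4.tendsto_subseq
  exact ⟨_, Set.mem_univ _, φ, hφ, hlim⟩

end Metric

end

end PairOrbits

theorem proposition2p7 (d : ℕ) (hd : 0 < d) :
    (∃ f : ℕ → PairOrbits.AllTestFn d, PairOrbits.IsDenseSequence f) ∧
    ∀ f : ℕ → PairOrbits.AllTestFn d, PairOrbits.IsDenseSequence f →
      (∀ (ξ : PairOrbits.Collection d) (r : ℕ), Summable (ξ.term (f r).2)) ∧
      (∀ ξ η : PairOrbits.Collection d, Summable (PairOrbits.D2term f ξ η)) ∧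
      ∃ m : MetricSpace (PairOrbits.Collection d),
        (∀ ξ η : PairOrbits.Collection d, m.dist ξ η = PairOrbits.D2 f ξ η) ∧
        @CompactSpace (PairOrbits.Collection d) m.toUniformSpace.toTopologicalSpace ∧
        @Dense (PairOrbits.Collection d) m.toUniformSpace.toTopologicalSpace
          (PairOrbits.probOrbits d) := by
  refine ⟨PairOrbits.exists_isDenseSequence d, fun f hf => ⟨fun ξ r => ?_, fun ξ η => ?_, ?_⟩⟩
  · exact ξ.summable_term (PairOrbits.one_le_index f r) (f r).2
  · exact PairOrbits.summable_D2term f ξ η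
  · exact ⟨PairOrbits.metricSpaceD2 hf, fun _ _ => rfl, PairOrbits.compactSpace_D2 hd hf,
      PairOrbits.dense_probOrbits hd hf⟩
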